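/- \textbf{Model.} Let $N\ge 1$ and $K,T_L,T_R>0$, put $E_0=T_L$, $E_{N+1}=T_R$ and $R(a,b)=\min\{K,\sqrt{\min(a,b)}\}$. The stochastic energy exchange process $\mathbf E_t=(E_1(t),\dots,E_N(t))$ is the Markov jump process on $\mathbb R_+^N=(0,\infty)^N$ driven by $N+1$ independent exponential clocks, the $i$-th of which rings at rate $R(E_{i-1},E_i)$, $1\le i\le N+1$. When clock $i$ with $2\le i\le N$ rings, $(E_{i-1},E_i)$ is replaced by $(p(E_{i-1}+E_i),(1-p)(E_{i-1}+E_i))$. When clock $1$ rings, $E_1$ is replaced by $p(E_1+X_L)$, and when clock $N+1$ rings, $E_N$ is replaced by $p(E_N+X_R)$. Here $p$ is uniform on $(0,1)$, $X_L$ and $X_R$ are exponential with means $T_L$ and $T_R$, and all these variables are drawn afresh and independently at each ring. Let $P^t(\mathbf E,\cdot)$ be the transition kernel of this process, and $P^tf(\mathbf E)=\int f(\mathbf x)\,P^t(\mathbf E,d\mathbf x)$. For $\eta>0$ let $$V(\mathbf E)=V_\eta(\mathbf E)=\sum_{m=1}^{N}\ \sum_{k=1}^{N-m+1}\Big(\sum_{j=0}^{m-1}E_{k+j}\Big)^{a_m\eta-1},\qquad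 a_m=1-\frac{2^{m-1}-1}{2^N-1}.$$ \textbf{Theorem.} There are $\eta_0>0$ and $h_0>0$, depending only on $N,K,T_L,T_R$, such that for all $0<\eta<\eta_0$ and $0<h<h_0$ there exist constants $c_0>0$ and $M_0>1$, depending only on $\eta$, $h$ and the parameters $N,K,T_L,T_R$ of the model, such that, for every $\mathbf E\in\mathbb R_+^N$ with $V(\mathbf E)>M_0$, the function $V$ is integrable with respect to $P^h(\mathbf E,\cdot)$ and $$P^hV(\mathbf E)-V(\mathbf E)\le -c_0\,V(\mathbf E)^{\alpha},\qquad \alpha=1-\frac1{2(1-\eta)}.$$ -/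

import Mathlib

open MeasureTheory ProbabilityTheory

noncomputable section

namespace EnergyExchange

/-- The stochastic energy exchange rate `R(a, b) = min {K, √(min (a, b))}`. -/
def rate (K a b : ℝ) : ℝ := min K (Real.sqrt (min a b))

/-- The uniform distribution on `(0, 1)`. -/
def unif : Measure ℝ := volume.restrict (Set.Ioo 0 1)

/-- Energy configurations of a chain of `n + 1` sites. The physical configurations are those with
all coordinates positive; the chain started from such a configuration never leaves them. -/
abbrev Config (n : ℕ) : Type := Fin (n + 1) → ℝ

/-- Exchange between the neighbouring sites `i` and `i + 1`: the pooled energy is redistributed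
with proportions `p` and `1 - p`. -/
def bulkExchange {n : ℕ} (i : Fin n) (z : Config n × ℝ) : Config n :=
  Function.update
    (Function.update z.1 i.castSucc (z.2 * (z.1 i.castSucc + z.1 i.succ)))
    i.succ ((1 - z.2) * (z.1 i.castSucc + z.1 i.succ))

/-- Exchange between a bath and the site `s` (an end of the chain): the energy becomes
`p (E_s + x)`, where `x` is the energy offered by the bath. The argument is `(E, (x, p))`. -/
def bathExchange {n : ℕ} (s : Fin (n + 1)) (z : Config n × (ℝ × ℝ)) : Config n :=
  Function.update z.1 s (z.2.2 * (z.1 s + z.2.1))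

lemma measurable_update_config {α : Type*} [MeasurableSpace α] {n : ℕ} (s : Fin (n + 1))
    {f : α → Config n} {g : α → ℝ} (hf : Measurable f) (hg : Measurable g) :
    Measurable fun a => Function.update (f a) s (g a) := by
  refine measurable_pi_lambda _ fun j => ?_
  by_cases h : j = s
  · subst h; simpa using hg
  · simp only [Function.update_of_ne h]; exact (measurable_pi_apply j).comp hf

lemma measurable_bulkExchange {n : ℕ} (i : Fin n) : Measurable (bulkExchange i) := by
  have h (j : Fin (n + 1)) : Measurable fun z : Config n × ℝ => z.1 j :=
    (measurable_pi_apply j).comp measurable_fst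
  exact measurable_update_config _
    (measurable_update_config _ measurable_fst (measurable_snd.mul ((h _).add (h _))))
    ((measurable_const.sub measurable_snd).mul ((h _).add (h _)))

lemma measurable_bathExchange {n : ℕ} (s : Fin (n + 1)) : Measurable (bathExchange s) := by
  have h (j : Fin (n + 1)) : Measurable fun z : Config n × (ℝ × ℝ) => z.1 j :=
    (measurable_pi_apply j).comp measurable_fst
  exact measurable_update_config _ measurable_fst
    (measurable_snd.snd.mul ((h _).add measurable_snd.fst))

/-- Law of the configuration after an exchange between sites `i` and `i + 1`. -/
def bulkLaw {n : ℕ} (i : Fin n) (E : Config n) : Measure (Config n) :=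
  unif.map fun p => bulkExchange i (E, p)

/-- Law of the configuration after an exchange of the end site `s` with a bath at temperature
`T`, which offers an exponential energy of mean `T`. -/
def bathLaw {n : ℕ} (s : Fin (n + 1)) (T : ℝ) (E : Config n) : Measure (Config n) :=
  ((expMeasure (1 / T)).prod unif).map fun w => bathExchange s (E, w)

/-- The rate at which the first clock rings: the sum of the rates of all `n + 2` clocks. -/
def totalRate {n : ℕ} (K TL TR : ℝ) (E : Config n) : ℝ :=
  (∑ i : Fin n, rate K (E i.castSucc) (E i.succ)) + rate K TL (E 0) + rate K (E (Fin.last n)) TR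

/-- The jump rate measure: each exchange law, weighted by the rate of its clock. -/
def jumpMeasure {n : ℕ} (K TL TR : ℝ) (E : Config n) : Measure (Config n) :=
  (∑ i : Fin n, ENNReal.ofReal (rate K (E i.castSucc) (E i.succ)) • bulkLaw i E) +
    ENNReal.ofReal (rate K TL (E 0)) • bathLaw 0 TL E +
    ENNReal.ofReal (rate K (E (Fin.last n)) TR) • bathLaw (Fin.last n) TR E

instance : IsProbabilityMeasure unif := ⟨by simp [unif]⟩

instance (r : ℝ) : SFinite (expMeasure r) := by
  unfold expMeasure gammaMeasure; infer_instance

lemma measurable_map_prodMk {α β γ : Type*} [MeasurableSpace α] [MeasurableSpace β]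
    [MeasurableSpace γ] (μ : Measure β) [SFinite μ] {f : α × β → γ} (hf : Measurable f) :
    Measurable fun a => μ.map fun b => f (a, b) := by
  refine Measure.measurable_of_measurable_coe _ fun B hB => ?_
  have h (a : α) : (μ.map fun b => f (a, b)) B = μ (Prod.mk a ⁻¹' (f ⁻¹' B)) :=
    Measure.map_apply (hf.comp measurable_prodMk_left) hB
  simp only [h]
  exact measurable_measure_prodMk_left (hf hB)

lemma measurable_rate {α : Type*} [MeasurableSpace α] (K : ℝ) {f g : α → ℝ}
    (hf : Measurable f) (hg : Measurable g) : Measurable fun a => rate K (f a) (g a) :=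
  measurable_const.min (hf.min hg).sqrt

lemma measurable_totalRate {n : ℕ} (K TL TR : ℝ) :
    Measurable (totalRate (n := n) K TL TR) := by
  refine Measurable.add (Measurable.add (Finset.measurable_sum _ fun i _ => ?_) ?_) ?_
  · exact measurable_rate K (measurable_pi_apply _) (measurable_pi_apply _)
  · exact measurable_rate K measurable_const (measurable_pi_apply _)
  · exact measurable_rate K (measurable_pi_apply _) measurable_const

lemma measurable_jumpMeasure {n : ℕ} (K TL TR : ℝ) :
    Measurable (jumpMeasure (n := n) K TL TR) := by
  have hb (i : Fin n) : Measurable (bulkLaw i) :=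
    measurable_map_prodMk unif (measurable_bulkExchange i)
  have he (s : Fin (n + 1)) (T : ℝ) : Measurable (bathLaw s T) :=
    measurable_map_prodMk _ (measurable_bathExchange s)
  have hr (a b : Config n → ℝ) (ha : Measurable a) (hb : Measurable b) :
      Measurable fun E => ENNReal.ofReal (rate K (a E) (b E)) :=
    (measurable_rate K ha hb).ennreal_ofReal
  refine Measure.measurable_of_measurable_coe _ fun B hB => ?_
  simp only [jumpMeasure, Measure.add_apply, Measure.finsetSum_apply, Measure.smul_apply,
    smul_eq_mul]
  refine Measurable.add (Measurable.add (Finset.measurable_sum _ fun i _ => ?_) ?_) ?_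
  · exact (hr _ _ (measurable_pi_apply _) (measurable_pi_apply _)).mul
      ((Measure.measurable_coe hB).comp (hb i))
  · exact (hr _ _ measurable_const (measurable_pi_apply _)).mul
      ((Measure.measurable_coe hB).comp (he _ _))
  · exact (hr _ _ (measurable_pi_apply _) measurable_const).mul
      ((Measure.measurable_coe hB).comp (he _ _))

/-- `jumpMeasure` as a kernel. -/
def jumpKernel {n : ℕ} (K TL TR : ℝ) : Kernel (Config n) (Config n) :=
  ⟨jumpMeasure K TL TR, measurable_jumpMeasure K TL TR⟩

lemma expMeasure_univ_le (r : ℝ) : expMeasure r Set.univ ≤ 1 := by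
  rcases lt_or_ge 0 r with hr | hr
  · have := isProbabilityMeasure_expMeasure hr
    exact prob_le_one
  · have h : ∀ x, gammaPDF 1 r x = 0 := fun x => by
      refine ENNReal.ofReal_of_nonpos ?_
      unfold gammaPDFReal
      split_ifs
      · simpa using mul_nonpos_of_nonpos_of_nonneg hr (Real.exp_pos _).le
      · exact le_rfl
    have h' : gammaPDF 1 r = 0 := funext h
    simp [expMeasure, gammaMeasure, h']

instance {n : ℕ} (K TL TR : ℝ) : IsFiniteKernel (jumpKernel (n := n) K TL TR) := by
  refine ⟨(n + 1 + 1) * ENNReal.ofReal K, ?_, fun E => ?_⟩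
  · exact ENNReal.mul_lt_top (by finiteness) ENNReal.ofReal_lt_top
  have hr (a b : ℝ) : ENNReal.ofReal (rate K a b) ≤ ENNReal.ofReal K :=
    ENNReal.ofReal_le_ofReal (min_le_left _ _)
  have hb (i : Fin n) : bulkLaw i E Set.univ ≤ 1 := by
    rw [bulkLaw, Measure.map_apply (f := fun p => bulkExchange i (E, p))
      ((measurable_bulkExchange i).comp measurable_prodMk_left) MeasurableSet.univ]
    exact prob_le_one
  have he (s : Fin (n + 1)) (T : ℝ) : bathLaw s T E Set.univ ≤ 1 := by
    rw [bathLaw, Measure.map_apply (f := fun w => bathExchange s (E, w))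
      ((measurable_bathExchange s).comp measurable_prodMk_left) MeasurableSet.univ, Set.preimage_univ, ← Set.univ_prod_univ, Measure.prod_prod]
    simpa using expMeasure_univ_le (1 / T)
  have hm (a b : ℝ) (m : ENNReal) (h : m ≤ 1) :
      ENNReal.ofReal (rate K a b) * m ≤ ENNReal.ofReal K := by
    simpa using mul_le_mul' (hr a b) h
  change jumpMeasure K TL TR E Set.univ ≤ _
  simp only [jumpMeasure, Measure.add_apply, Measure.finsetSum_apply, Measure.smul_apply,
    smul_eq_mul, add_mul, one_mul]
  refine add_le_add (add_le_add ?_ (hm _ _ _ (he _ _))) (hm _ _ _ (he _ _))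
  refine (Finset.sum_le_sum fun i _ => hm _ _ _ (hb i)).trans ?_
  simp

/-- Contribution of the paths without any ring of a clock up to time `t`: the argument is
`(t, E)`, and the chain is still at `E` with probability `exp (- totalRate E * t)`. -/
def noJump {n : ℕ} (K TL TR : ℝ) : Kernel (ℝ × Config n) (Config n) where
  toFun z := ENNReal.ofReal (Real.exp (-(totalRate K TL TR z.2 * z.1))) • Measure.dirac z.2
  measurable' := by
    refine Measure.measurable_of_measurable_coe _ fun B hB => ?_
    simp only [Measure.smul_apply, smul_eq_mul]
    refine Measurable.mul ?_
      ((Measure.measurable_coe hB).comp (Measure.measurable_dirac.comp measurable_snd))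
    exact (((measurable_totalRate K TL TR).comp measurable_snd).mul
      measurable_fst).neg.exp.ennreal_ofReal

/-- Integrand of `firstJump`: the first ring takes place at time `s`, at which the configuration
jumps from `z.2` to `y` at rate `jumpMeasure z.2 (dy)`, and the rest of the path follows `κ` for
the remaining time `z.1 - s`. -/
def firstJumpAt {n : ℕ} (K TL TR : ℝ) (κ : Kernel (ℝ × Config n) (Config n))
    (z : ℝ × Config n) (s : ℝ) : Measure (Config n) :=
  ENNReal.ofReal (Real.exp (-(totalRate K TL TR z.2 * s))) •
    (jumpMeasure K TL TR z.2).bind fun y => κ (z.1 - s, y)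

lemma firstJumpAt_apply {n : ℕ} (K TL TR : ℝ) (κ : Kernel (ℝ × Config n) (Config n))
    (z : ℝ × Config n) (s : ℝ) {B : Set (Config n)} (hB : MeasurableSet B) :
    firstJumpAt K TL TR κ z s B = ENNReal.ofReal (Real.exp (-(totalRate K TL TR z.2 * s))) *
      ∫⁻ y, κ (z.1 - s, y) B ∂jumpMeasure K TL TR z.2 := by
  rw [firstJumpAt, Measure.smul_apply, smul_eq_mul, Measure.bind_apply hB]
  exact (κ.measurable.comp measurable_prodMk_left).aemeasurable

lemma measurable_firstJumpAt {n : ℕ} (K TL TR : ℝ) (κ : Kernel (ℝ × Config n) (Config n)) :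
    Measurable fun w : (ℝ × Config n) × ℝ => firstJumpAt K TL TR κ w.1 w.2 := by
  refine Measure.measurable_of_measurable_coe _ fun B hB => ?_
  simp only [firstJumpAt_apply K TL TR κ _ _ hB]
  refine Measurable.mul ?_ ?_
  · exact (((measurable_totalRate K TL TR).comp measurable_fst.snd).mul
      measurable_snd).neg.exp.ennreal_ofReal
  · have hg : Measurable fun w : ((ℝ × Config n) × ℝ) × Config n =>
        κ (w.1.1.1 - w.1.2, w.2) B :=
      (κ.measurable_coe hB).comp
        ((measurable_fst.fst.fst.sub measurable_fst.snd).prodMk measurable_snd)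
    exact hg.lintegral_kernel_prod_right'
      (κ := (jumpKernel K TL TR).comap (fun w : (ℝ × Config n) × ℝ => w.1.2)
        measurable_fst.snd)

lemma firstJump_apply_aux {n : ℕ} (K TL TR : ℝ) (κ : Kernel (ℝ × Config n) (Config n))
    (z : ℝ × Config n) {B : Set (Config n)} (hB : MeasurableSet B) :
    (volume.restrict (Set.Ioc 0 z.1)).bind (firstJumpAt K TL TR κ z) B =
      ∫⁻ s in Set.Ioc 0 z.1, firstJumpAt K TL TR κ z s B :=
  Measure.bind_apply hB
    ((measurable_firstJumpAt K TL TR κ).comp measurable_prodMk_left).aemeasurable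

/-- Contribution of the paths with at least one ring up to time `t`, when the path after the first
ring contributes according to `κ`; as a function of `(t, E)`. -/
def firstJump {n : ℕ} (K TL TR : ℝ) (κ : Kernel (ℝ × Config n) (Config n)) :
    Kernel (ℝ × Config n) (Config n) where
  toFun z := (volume.restrict (Set.Ioc 0 z.1)).bind (firstJumpAt K TL TR κ z)
  measurable' := by
    refine Measure.measurable_of_measurable_coe _ fun B hB => ?_
    simp only [firstJump_apply_aux K TL TR κ _ hB]
    have h (z : ℝ × Config n) : ∫⁻ s in Set.Ioc 0 z.1, firstJumpAt K TL TR κ z s B =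
        ∫⁻ s, {w : (ℝ × Config n) × ℝ | 0 < w.2 ∧ w.2 ≤ w.1.1}.indicator
          (fun w => firstJumpAt K TL TR κ w.1 w.2 B) (z, s) := by
      rw [← lintegral_indicator measurableSet_Ioc]
      rfl
    simp only [h]
    refine Measurable.lintegral_prod_right' (Measurable.indicator ?_ ?_)
    · exact (Measure.measurable_coe hB).comp (measurable_firstJumpAt K TL TR κ)
    · exact (measurableSet_lt measurable_const measurable_snd).inter
        (measurableSet_le measurable_snd measurable_fst.fst)

/-- `jumpCount K TL TR m (t, E) B` is the probability, for the chain started from `E`, that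
exactly `m` clocks ring up to time `t` and that the configuration at time `t` lies in `B`. -/
def jumpCount {n : ℕ} (K TL TR : ℝ) : ℕ → Kernel (ℝ × Config n) (Config n)
  | 0 => noJump K TL TR
  | m + 1 => firstJump K TL TR (jumpCount K TL TR m)

/-- The transition kernel `P^t` of the energy exchange process, a Markov jump process with bounded
rates: the sum over the number of rings up to time `t`. -/
def transition {n : ℕ} (K TL TR t : ℝ) : Kernel (Config n) (Config n) :=
  (Kernel.sum (jumpCount K TL TR)).comap (fun E => (t, E)) measurable_prodMk_left

lemma jumpCount_zero_apply {n : ℕ} (K TL TR t : ℝ) (E : Config n) :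
    jumpCount K TL TR 0 (t, E) =
      ENNReal.ofReal (Real.exp (-(totalRate K TL TR E * t))) • Measure.dirac E := rfl

lemma jumpCount_succ_apply {n : ℕ} (K TL TR : ℝ) (m : ℕ) (t : ℝ) (E : Config n)
    {B : Set (Config n)} (hB : MeasurableSet B) :
    jumpCount K TL TR (m + 1) (t, E) B =
      ∫⁻ s in Set.Ioc 0 t, ENNReal.ofReal (Real.exp (-(totalRate K TL TR E * s))) *
        ∫⁻ y, jumpCount K TL TR m (t - s, y) B ∂jumpMeasure K TL TR E := by
  refine (firstJump_apply_aux K TL TR _ (t, E) hB).trans ?_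
  simp only [firstJumpAt_apply K TL TR _ _ _ hB]

lemma transition_apply {n : ℕ} (K TL TR t : ℝ) (E : Config n) :
    transition K TL TR t E = Measure.sum fun m => jumpCount K TL TR m (t, E) := by
  rw [transition, Kernel.comap_apply, Kernel.sum_apply]

/-- The exponent coefficients `a_m = 1 - (2 ^ (m - 1) - 1) / (2 ^ N - 1)` for a chain of `N`
sites, `1 ≤ m ≤ N`. -/
def coeff (N m : ℕ) : ℝ := 1 - (2 ^ (m - 1) - 1) / (2 ^ N - 1)

/-- The energy of the block of the `m` consecutive sites `k, k + 1, …, k + m - 1`, the sites being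
numbered from `1` (so that the site with index `j : Fin (n + 1)` has number `j + 1`). -/
def blockEnergy {n : ℕ} (E : Config n) (m k : ℕ) : ℝ :=
  ∑ j : Fin (n + 1), if k ≤ (j : ℕ) + 1 ∧ (j : ℕ) + 1 < k + m then E j else 0

/-- The function `V`: the sum, over all blocks of consecutive sites of the chain of `n + 1` sites,
of the power `a_m η - 1` of the block energy, `m` being the length of the block. -/
def lyapunov {n : ℕ} (η : ℝ) (E : Config n) : ℝ :=
  ∑ m ∈ Finset.Icc 1 (n + 1), ∑ k ∈ Finset.Icc 1 (n + 1 - m + 1),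
    blockEnergy E m k ^ (coeff (n + 1) m * η - 1)

end EnergyExchange

end

noncomputable section

namespace EnergyExchange

/-! `V` is large only when some block of consecutive sites carries little energy. The proof bounds
the drift of `V` at a single ring, then passes to time `h`.

Gain: let a clock straddling the boundary of a block of length m ring, and let S be the energy of
the block enlarged by the site across the boundary. The new block energy is at least pS (or (1-p)S),
and the mean of p^(b-1) is 1/b, where b = a_m η, so the new block term has mean at most S^(b-1)/b.
The rate of the clock is at most S^(1/2), so the gain is of order S^(-(1/2 - a_m η)), whereas V ≥
S^(-(1 - a_{m+1} η)). Since 1 - a_{m+1} = 2(1 - a_m) + 1/(2^N - 1), for small η this gain is of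
lower order than V^α (`coeff_gap`, `exists_mul_rpow_le`). A bath ring gives a bounded gain, because
the bath supplies an exponential energy.

Loss: every block is affected by some clock, and all rates are at least κ min(1, √x), where x is the
smallest site energy. Hence the loss is at least κ min(1, √x) V. As V ≥ x^(η-1), one has √x ≥
V^(-1/(2(1-η))), and the loss is at least κ(V^α - 1) (`exists_lyapunov_rpow_le_loss`).

Time step: `lintegral_transition_add_le` integrates this drift over [0, h] by induction on the
number of rings. The term V^α is used only before the first ring, while the configuration is still
the initial one, and this has probability bounded below because the rates are bounded. -/

lemma rate_nonneg {K : ℝ} (hK : 0 ≤ K) (a b : ℝ) : 0 ≤ rate K a b :=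
  le_min hK (Real.sqrt_nonneg _)

lemma totalRate_nonneg {n : ℕ} {K : ℝ} (hK : 0 ≤ K) (TL TR : ℝ) (E : Config n) :
    0 ≤ totalRate K TL TR E :=
  add_nonneg (add_nonneg (Finset.sum_nonneg fun _ _ => rate_nonneg hK _ _) (rate_nonneg hK _ _))
    (rate_nonneg hK _ _)

lemma totalRate_le {n : ℕ} (K TL TR : ℝ) (E : Config n) :
    totalRate K TL TR E ≤ (n + 2) * K := by
  have h : ∑ i : Fin n, rate K (E i.castSucc) (E i.succ) ≤ ∑ _i : Fin n, K :=
    Finset.sum_le_sum fun i _ => min_le_left _ _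
  have h1 : rate K TL (E 0) ≤ K := min_le_left _ _
  have h2 : rate K (E (Fin.last n)) TR ≤ K := min_le_left _ _
  simp only [Finset.sum_const, Finset.card_univ, Fintype.card_fin, nsmul_eq_mul] at h
  unfold totalRate
  linarith

lemma lintegral_bulkLaw {n : ℕ} (i : Fin n) (E : Config n) {f : Config n → ENNReal}
    (hf : Measurable f) : ∫⁻ y, f y ∂bulkLaw i E = ∫⁻ p, f (bulkExchange i (E, p)) ∂unif :=
  lintegral_map hf ((measurable_bulkExchange i).comp measurable_prodMk_left)

lemma lintegral_bathLaw {n : ℕ} (s : Fin (n + 1)) (T : ℝ) (E : Config n) {f : Config n → ENNReal}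
    (hf : Measurable f) : ∫⁻ y, f y ∂bathLaw s T E =
      ∫⁻ w, f (bathExchange s (E, w)) ∂(expMeasure (1 / T)).prod unif :=
  lintegral_map hf ((measurable_bathExchange s).comp measurable_prodMk_left)

lemma lintegral_jumpMeasure {n : ℕ} (K TL TR : ℝ) (E : Config n) (f : Config n → ENNReal) :
    ∫⁻ y, f y ∂jumpMeasure K TL TR E =
      (∑ i : Fin n, ENNReal.ofReal (rate K (E i.castSucc) (E i.succ)) * ∫⁻ y, f y ∂bulkLaw i E) +
        ENNReal.ofReal (rate K TL (E 0)) * ∫⁻ y, f y ∂bathLaw 0 TL E +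
        ENNReal.ofReal (rate K (E (Fin.last n)) TR) * ∫⁻ y, f y ∂bathLaw (Fin.last n) TR E := by
  simp only [jumpMeasure, lintegral_add_measure, lintegral_finsetSum_measure,
    lintegral_smul_measure, smul_eq_mul]

lemma ae_unif : ∀ᵐ p ∂unif, p ∈ Set.Ioo (0 : ℝ) 1 := ae_restrict_mem measurableSet_Ioo

lemma ae_expMeasure (r : ℝ) : ∀ᵐ x ∂expMeasure r, 0 < x := by
  rw [ae_iff]
  have : {x : ℝ | ¬ 0 < x} = Set.Iic 0 := by ext; simp
  -- The density vanishes on the negative axis but not at 0, so the null point 0 is dropped first.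
  rw [this, expMeasure, gammaMeasure, withDensity_apply _ measurableSet_Iic,
    setLIntegral_congr Iio_ae_eq_Iic.symm, setLIntegral_congr_fun (g := fun _ => 0)
      measurableSet_Iio]
  · simp
  · intro x hx
    exact gammaPDF_of_neg hx

lemma bulkExchange_pos {n : ℕ} (i : Fin n) {E : Config n} (hE : ∀ j, 0 < E j) {p : ℝ}
    (hp : p ∈ Set.Ioo (0 : ℝ) 1) (j : Fin (n + 1)) : 0 < bulkExchange i (E, p) j := by
  have hS : 0 < E i.castSucc + E i.succ := add_pos (hE _) (hE _)
  simp only [bulkExchange, Function.update_apply]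
  split_ifs
  · exact mul_pos (by linarith [hp.2]) hS
  · exact mul_pos hp.1 hS
  · exact hE j

lemma bathExchange_pos {n : ℕ} (s : Fin (n + 1)) {E : Config n} (hE : ∀ j, 0 < E j) {x p : ℝ}
    (hx : 0 < x) (hp : p ∈ Set.Ioo (0 : ℝ) 1) (j : Fin (n + 1)) :
    0 < bathExchange s (E, (x, p)) j := by
  simp only [bathExchange, Function.update_apply]
  split_ifs
  · exact mul_pos hp.1 (add_pos (hE _) hx)
  · exact hE j

lemma measurableSet_pos (n : ℕ) : MeasurableSet {y : Config n | ∀ j, 0 < y j} := by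
  simp only [Set.ofPred_forall]
  exact MeasurableSet.iInter fun j => measurableSet_lt measurable_const (measurable_pi_apply j)

lemma ae_prod_exp_unif (r : ℝ) :
    ∀ᵐ w ∂(expMeasure r).prod unif, 0 < w.1 ∧ w.2 ∈ Set.Ioo (0 : ℝ) 1 :=
  (Measure.quasiMeasurePreserving_fst.ae (ae_expMeasure r)).and
    (Measure.quasiMeasurePreserving_snd.ae ae_unif)

lemma ae_bulkLaw_pos {n : ℕ} (i : Fin n) {E : Config n} (hE : ∀ j, 0 < E j) :
    ∀ᵐ y ∂bulkLaw i E, ∀ j, 0 < y j := by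
  rw [bulkLaw, ae_map_iff (f := fun p => bulkExchange i (E, p)) ((measurable_bulkExchange i).comp
    measurable_prodMk_left).aemeasurable (measurableSet_pos n)]
  exact ae_unif.mono fun p hp => bulkExchange_pos i hE hp

lemma ae_bathLaw_pos {n : ℕ} (s : Fin (n + 1)) (T : ℝ) {E : Config n} (hE : ∀ j, 0 < E j) :
    ∀ᵐ y ∂bathLaw s T E, ∀ j, 0 < y j := by
  rw [bathLaw, ae_map_iff (f := fun w => bathExchange s (E, w)) ((measurable_bathExchange s).comp
    measurable_prodMk_left).aemeasurable (measurableSet_pos n)]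
  exact (ae_prod_exp_unif _).mono fun w hw => bathExchange_pos s hE hw.1 hw.2

/-- Real powers of block energies behave well only on positive configurations. Exchanges almost
surely preserve positivity, so comparisons are needed only there. -/
lemma lintegral_jumpMeasure_mono {n : ℕ} (K TL TR : ℝ) {E : Config n} (hE : ∀ j, 0 < E j)
    {f g : Config n → ENNReal} (h : ∀ y : Config n, (∀ j, 0 < y j) → f y ≤ g y) :
    ∫⁻ y, f y ∂jumpMeasure K TL TR E ≤ ∫⁻ y, g y ∂jumpMeasure K TL TR E := by
  simp only [lintegral_jumpMeasure]
  have hb (s : Fin (n + 1)) (T : ℝ) : ∫⁻ y, f y ∂bathLaw s T E ≤ ∫⁻ y, g y ∂bathLaw s T E :=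
    lintegral_mono_ae ((ae_bathLaw_pos s T hE).mono h)
  exact add_le_add (add_le_add (Finset.sum_le_sum fun i _ =>
    mul_le_mul_right (lintegral_mono_ae ((ae_bulkLaw_pos i hE).mono h)) _)
    (mul_le_mul_right (hb _ _) _)) (mul_le_mul_right (hb _ _) _)

lemma jumpMeasure_univ_le {n : ℕ} {K : ℝ} (hK : 0 ≤ K) (TL TR : ℝ) (E : Config n) :
    jumpMeasure K TL TR E Set.univ ≤ ENNReal.ofReal (totalRate K TL TR E) := by
  have hb (i : Fin n) : bulkLaw i E Set.univ ≤ 1 := by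
    rw [bulkLaw, Measure.map_apply (f := fun p => bulkExchange i (E, p))
      ((measurable_bulkExchange i).comp measurable_prodMk_left) MeasurableSet.univ]
    exact prob_le_one
  have he (s : Fin (n + 1)) (T : ℝ) : bathLaw s T E Set.univ ≤ 1 := by
    rw [bathLaw, Measure.map_apply (f := fun w => bathExchange s (E, w))
      ((measurable_bathExchange s).comp measurable_prodMk_left) MeasurableSet.univ,
      Set.preimage_univ, ← Set.univ_prod_univ, Measure.prod_prod]
    simpa using expMeasure_univ_le (1 / T)
  have hm (a b : ℝ) (m : ENNReal) (h : m ≤ 1) :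
      ENNReal.ofReal (rate K a b) * m ≤ ENNReal.ofReal (rate K a b) := by
    simpa using mul_le_mul' (le_refl (ENNReal.ofReal (rate K a b))) h
  rw [totalRate, ENNReal.ofReal_add (add_nonneg (Finset.sum_nonneg fun _ _ => rate_nonneg hK _ _)
    (rate_nonneg hK _ _)) (rate_nonneg hK _ _), ENNReal.ofReal_add (Finset.sum_nonneg fun _ _ =>
    rate_nonneg hK _ _) (rate_nonneg hK _ _),
    ENNReal.ofReal_sum_of_nonneg fun _ _ => rate_nonneg hK _ _]
  simp only [jumpMeasure, Measure.add_apply, Measure.finsetSum_apply, Measure.smul_apply,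
    smul_eq_mul]
  exact add_le_add (add_le_add (Finset.sum_le_sum fun i _ => hm _ _ _ (hb i)) (hm _ _ _ (he _ _)))
    (hm _ _ _ (he _ _))

/-! ### Recursion on the first ring, and integration of the drift in time -/

lemma lintegral_jumpCount_zero {n : ℕ} (K TL TR t : ℝ) (E : Config n) {f : Config n → ENNReal}
    (hf : Measurable f) : ∫⁻ y, f y ∂jumpCount K TL TR 0 (t, E) =
      ENNReal.ofReal (Real.exp (-(totalRate K TL TR E * t))) * f E := by
  rw [jumpCount_zero_apply, lintegral_smul_measure, lintegral_dirac' _ hf, smul_eq_mul]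

lemma lintegral_jumpCount_succ {n : ℕ} (K TL TR : ℝ) (m : ℕ) (t : ℝ) (E : Config n)
    {f : Config n → ENNReal} (hf : Measurable f) :
    ∫⁻ y, f y ∂jumpCount K TL TR (m + 1) (t, E) =
      ∫⁻ s in Set.Ioc 0 t, ENNReal.ofReal (Real.exp (-(totalRate K TL TR E * s))) *
        ∫⁻ y, (∫⁻ x, f x ∂jumpCount K TL TR m (t - s, y)) ∂jumpMeasure K TL TR E := by
  have h : jumpCount K TL TR (m + 1) (t, E) = (volume.restrict (Set.Ioc 0 t)).bind
      (firstJumpAt K TL TR (jumpCount K TL TR m) (t, E)) := rfl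
  rw [h, Measure.lintegral_bind (μ := firstJumpAt K TL TR (jumpCount K TL TR m) (t, E))
    ((measurable_firstJumpAt K TL TR _).comp measurable_prodMk_left).aemeasurable hf.aemeasurable]
  refine lintegral_congr fun s => ?_
  rw [firstJumpAt, lintegral_smul_measure, Measure.lintegral_bind _ hf.aemeasurable, smul_eq_mul]
  exact ((jumpCount K TL TR m).measurable.comp measurable_prodMk_left).aemeasurable

/-- The integrand is the derivative of -e^(-rs)(v + C(t - s)). The missing e^(-rt) v is exactly the
contribution of the paths without a ring. -/
lemma lintegral_exp_mul (r v C t : ℝ) (hr : 0 ≤ r) (hv : 0 ≤ v) (hC : 0 ≤ C) (ht : 0 ≤ t) :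
    ∫⁻ s in Set.Ioc 0 t, ENNReal.ofReal (Real.exp (-(r * s)) * (r * v + C + r * (C * (t - s)))) =
      ENNReal.ofReal (v + C * t - Real.exp (-(r * t)) * v) := by
  have hc : Continuous fun s : ℝ => Real.exp (-(r * s)) * (r * v + C + r * (C * (t - s))) := by
    fun_prop
  rw [← ofReal_integral_eq_lintegral_ofReal, ← intervalIntegral.integral_of_le ht]
  · congr 1
    rw [intervalIntegral.integral_eq_sub_of_hasDerivAt
      (f := fun s => -(Real.exp (-(r * s)) * (v + C * (t - s)))) _ (hc.intervalIntegrable _ _)]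
    · simp; ring
    · intro s _
      have h1 : HasDerivAt (fun s : ℝ => -(r * s)) (-r) s := by
        simpa only [mul_one] using ((hasDerivAt_id' s).const_mul r).fun_neg
      have h2 : HasDerivAt (fun s : ℝ => v + C * (t - s)) (-C) s := by
        simpa using (((hasDerivAt_id s).const_sub t).const_mul C).const_add v
      convert (h1.exp.fun_mul h2).fun_neg using 1
      ring
  · exact (hc.integrableOn_Ioc)
  · refine (ae_restrict_mem measurableSet_Ioc).mono fun s hs => ?_
    have : 0 ≤ t - s := by linarith [hs.2]
    positivity

/-- A drift inequality for the jump measure integrates to one for the transition kernel. -/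
lemma lintegral_transition_add_le {n : ℕ} {K TL TR : ℝ} (hK : 0 ≤ K) {V W : Config n → ℝ} {C : ℝ}
    (hV : Measurable V) (hV0 : ∀ E : Config n, (∀ j, 0 < E j) → 0 ≤ V E) (hC : 0 ≤ C)
    (hJ : ∀ E : Config n, (∀ j, 0 < E j) → ∫⁻ y, ‖V y‖ₑ ∂jumpMeasure K TL TR E +
      ENNReal.ofReal (W E) ≤ ENNReal.ofReal (totalRate K TL TR E * V E + C))
    {t : ℝ} (ht : 0 ≤ t) {E : Config n} (hE : ∀ j, 0 < E j) :
    ∫⁻ y, ‖V y‖ₑ ∂transition K TL TR t E + ENNReal.ofReal (W E) *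
      ∫⁻ s in Set.Ioc 0 t, ENNReal.ofReal (Real.exp (-(totalRate K TL TR E * s))) ≤
      ENNReal.ofReal (V E + C * t) := by
  have hf : Measurable fun y => ‖V y‖ₑ := hV.enorm
  have hVe (y : Config n) (hy : ∀ j, 0 < y j) : ‖V y‖ₑ = ENNReal.ofReal (V y) :=
    Real.enorm_of_nonneg (hV0 y hy)
  -- Truncation to fewer than M rings makes induction possible before integrability is known; the
  -- full sum is a supremum over M.
  set S : ℕ → ℝ → Config n → ENNReal := fun M t E =>
    ∑ m ∈ Finset.range M, ∫⁻ y, ‖V y‖ₑ ∂jumpCount K TL TR m (t, E) with hS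
  have hm (m : ℕ) : Measurable fun z : ℝ × Config n => ∫⁻ y, ‖V y‖ₑ ∂jumpCount K TL TR m z :=
    hf.lintegral_kernel
  -- The loss W is kept only up to the first ring. Afterwards the bound `hM` without W is enough, so
  -- W never has to be followed along the path.
  have step (M : ℕ) (hM : ∀ t : ℝ, 0 ≤ t → ∀ E : Config n, (∀ j, 0 < E j) →
      S M t E ≤ ENNReal.ofReal (V E + C * t)) (t : ℝ) (ht : 0 ≤ t) (E : Config n)
      (hE : ∀ j, 0 < E j) : S (M + 1) t E + ENNReal.ofReal (W E) *
      ∫⁻ s in Set.Ioc 0 t, ENNReal.ofReal (Real.exp (-(totalRate K TL TR E * s))) ≤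
      ENNReal.ofReal (V E + C * t) := by
    have hr := totalRate_nonneg hK TL TR E
    have hv := hV0 E hE
    have hme : Measurable fun s : ℝ =>
        ENNReal.ofReal (Real.exp (-(totalRate K TL TR E * s))) := by fun_prop
    have key : ∑ m ∈ Finset.range M, ∫⁻ y, ‖V y‖ₑ ∂jumpCount K TL TR (m + 1) (t, E) +
        ENNReal.ofReal (W E) *
        ∫⁻ s in Set.Ioc 0 t, ENNReal.ofReal (Real.exp (-(totalRate K TL TR E * s))) ≤
        ENNReal.ofReal (V E + C * t - Real.exp (-(totalRate K TL TR E * t)) * V E) := by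
      have e1 : ∑ m ∈ Finset.range M, ∫⁻ y, ‖V y‖ₑ ∂jumpCount K TL TR (m + 1) (t, E) =
          ∫⁻ s in Set.Ioc 0 t, ENNReal.ofReal (Real.exp (-(totalRate K TL TR E * s))) *
            ∫⁻ y, S M (t - s) y ∂jumpMeasure K TL TR E := by
        simp only [lintegral_jumpCount_succ K TL TR _ t E hf, hS]
        rw [← lintegral_finsetSum]
        · refine lintegral_congr fun s => ?_
          rw [lintegral_finsetSum, Finset.mul_sum]
          exact fun m _ => (hm m).comp measurable_prodMk_left
        · intro m _
          refine hme.mul ?_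
          exact Measurable.lintegral_kernel_prod_right'
            (κ := (jumpKernel K TL TR).comap (fun _ : ℝ => E) measurable_const)
            (f := fun z : ℝ × Config n => ∫⁻ y, ‖V y‖ₑ ∂jumpCount K TL TR m (t - z.1, z.2))
            ((hm m).comp ((measurable_const.sub measurable_fst).prodMk measurable_snd))
      rw [e1, ← lintegral_const_mul _ hme, ← lintegral_add_right _ (hme.const_mul _),
        ← lintegral_exp_mul _ _ _ _ hr hv hC ht]
      refine setLIntegral_mono' measurableSet_Ioc fun s hs => ?_
      have hts : 0 ≤ t - s := by linarith [hs.2]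
      rw [mul_comm (ENNReal.ofReal (W E)), ← mul_add, ENNReal.ofReal_mul (Real.exp_pos _).le]
      gcongr
      have h1 : ∫⁻ y, S M (t - s) y ∂jumpMeasure K TL TR E ≤
          ∫⁻ y, ‖V y‖ₑ ∂jumpMeasure K TL TR E +
            ENNReal.ofReal (totalRate K TL TR E * (C * (t - s))) := by
        calc _ ≤ ∫⁻ y, (‖V y‖ₑ + ENNReal.ofReal (C * (t - s))) ∂jumpMeasure K TL TR E := by
              refine lintegral_jumpMeasure_mono K TL TR hE fun y hy => ?_
              rw [hVe y hy, ← ENNReal.ofReal_add (hV0 y hy) (by positivity)]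
              exact hM _ hts y hy
          _ ≤ _ := by
              rw [lintegral_add_left hf, lintegral_const, mul_comm, ENNReal.ofReal_mul hr]
              gcongr
              exact jumpMeasure_univ_le hK TL TR E
      calc _ ≤ (∫⁻ y, ‖V y‖ₑ ∂jumpMeasure K TL TR E +
            ENNReal.ofReal (totalRate K TL TR E * (C * (t - s)))) + ENNReal.ofReal (W E) :=
            add_le_add h1 le_rfl
        _ = (∫⁻ y, ‖V y‖ₑ ∂jumpMeasure K TL TR E + ENNReal.ofReal (W E)) +
            ENNReal.ofReal (totalRate K TL TR E * (C * (t - s))) := by ring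
        _ ≤ ENNReal.ofReal (totalRate K TL TR E * V E + C) +
            ENNReal.ofReal (totalRate K TL TR E * (C * (t - s))) := by gcongr; exact hJ E hE
        _ = _ := by rw [← ENNReal.ofReal_add (by positivity) (by positivity)]
    have h0 : Real.exp (-(totalRate K TL TR E * t)) * V E ≤ V E :=
      mul_le_of_le_one_left hv (Real.exp_le_one_iff.2 (neg_nonpos.2 (by positivity)))
    have hCt : 0 ≤ C * t := by positivity
    simp only [hS, Finset.sum_range_succ' _ M, lintegral_jumpCount_zero K TL TR t E hf]
    rw [add_right_comm]
    refine (add_le_add key le_rfl).trans ?_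
    rw [hVe E hE, ← ENNReal.ofReal_mul (Real.exp_pos _).le, ← ENNReal.ofReal_add (by linarith)
      (by positivity)]
    simp
  have hall (M : ℕ) : ∀ t : ℝ, 0 ≤ t → ∀ E : Config n, (∀ j, 0 < E j) →
      S M t E ≤ ENNReal.ofReal (V E + C * t) := by
    induction M with
    | zero => intro t _ E _; simp [hS]
    | succ M ih => exact fun t ht E hE => le_self_add.trans (step M ih t ht E hE)
  rw [transition_apply, lintegral_sum_measure, ENNReal.tsum_eq_iSup_nat, ENNReal.iSup_add]
  refine iSup_le fun M => ?_
  refine le_trans ?_ (step M (hall M) t ht E hE)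
  gcongr
  exact Finset.sum_le_sum_of_subset (Finset.range_mono M.le_succ)

/-! ### The exponents a_m -/

section Coeff

lemma coeff_one (N : ℕ) : coeff N 1 = 1 := by simp [coeff]

lemma coeff_le_one {N : ℕ} (m : ℕ) : coeff N m ≤ 1 := by
  have h1 : (1 : ℝ) ≤ 2 ^ (m - 1) := one_le_pow₀ (by norm_num)
  have h2 : (1 : ℝ) ≤ 2 ^ N := one_le_pow₀ (by norm_num)
  exact sub_le_self _ (div_nonneg (by linarith) (by linarith))

lemma coeff_pos {N m : ℕ} (hm : 1 ≤ m) (hmN : m ≤ N) : 0 < coeff N m := by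
  have h2 : (2 : ℝ) ^ (m - 1) < 2 ^ N := pow_lt_pow_right₀ (by norm_num) (by omega)
  have h1 : (1 : ℝ) ≤ 2 ^ (m - 1) := one_le_pow₀ (by norm_num)
  rw [coeff, sub_pos, div_lt_one (by linarith)]
  linarith

/-- The gaps between the coefficients are large enough for the loss terms to beat the gains. -/
lemma coeff_gap {n m : ℕ} (hm : 1 ≤ m) (hmn : m ≤ n) {η : ℝ} (h0 : 0 < η)
    (h : η < 1 / 2 ^ (n + 2)) :
    1 / 2 - coeff (n + 1) m * η <
      (1 - coeff (n + 1) (m + 1) * η) * (1 - 1 / (2 * (1 - η))) := by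
  obtain ⟨j, rfl⟩ : ∃ j, m = j + 1 := ⟨m - 1, by omega⟩
  have hN : (2 : ℝ) ≤ 2 ^ (n + 1) := by
    calc (2 : ℝ) = 2 ^ 1 := by norm_num
      _ ≤ _ := pow_le_pow_right₀ (by norm_num) (by omega)
  have hj : (2 : ℝ) ^ j ≤ 2 ^ (n + 1) := pow_le_pow_right₀ (by norm_num) (by omega)
  have hη : η * (2 * 2 ^ (n + 1)) < 1 := by
    rw [lt_div_iff₀ (by positivity)] at h
    calc η * (2 * 2 ^ (n + 1)) = η * 2 ^ (n + 2) := by ring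
      _ < 1 := h
  have hη1 : η < 1 / 4 := by nlinarith
  have hpow : (2 : ℝ) ^ (j + 1) = 2 ^ j * 2 := pow_succ 2 j
  simp only [coeff, Nat.add_sub_cancel, hpow]
  set D : ℝ := 2 ^ (n + 1) - 1
  set u : ℝ := 2 ^ j
  have hD : 0 < D := by simp only [D]; linarith
  have hu : η * (2 * u) < 1 := lt_of_le_of_lt (by gcongr) hη
  -- The gap computed exactly, with u = 2^(m-1) and D = 2^N - 1. The upper bound on η is what makes
  -- 1 - 2uη positive.
  have key : (1 - (1 - (u * 2 - 1) / D) * η) * (1 - 1 / (2 * (1 - η))) -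
      (1 / 2 - (1 - (u - 1) / D) * η) = η / D * (1 - η * (2 * u)) / (2 * (1 - η)) := by
    have : 1 - η ≠ 0 := by linarith
    field_simp
    ring
  have : 0 < η / D * (1 - η * (2 * u)) / (2 * (1 - η)) :=
    div_pos (mul_pos (div_pos h0 hD) (by linarith)) (by linarith)
  linarith

end Coeff

/-! ### Moments of negative order and comparison of powers -/

section Powers

lemma lintegral_rpow_unif {b : ℝ} (hb : 0 < b) :
    ∫⁻ p, ENNReal.ofReal (p ^ (b - 1)) ∂unif = ENNReal.ofReal (1 / b) := by
  have hi : IntervalIntegrable (fun p : ℝ => p ^ (b - 1)) volume 0 1 :=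
    intervalIntegral.intervalIntegrable_rpow' (by linarith)
  rw [unif, restrict_Ioo_eq_restrict_Ioc, ← ofReal_integral_eq_lintegral_ofReal,
    ← intervalIntegral.integral_of_le zero_le_one, integral_rpow (Or.inl (by linarith))]
  · simp [hb.ne']
  · exact (intervalIntegrable_iff_integrableOn_Ioc_of_le zero_le_one).1 hi
  · exact (ae_restrict_mem measurableSet_Ioc).mono fun p hp => Real.rpow_nonneg hp.1.le _

lemma lintegral_unif_reflect (f : ℝ → ENNReal) :
    ∫⁻ p, f (1 - p) ∂unif = ∫⁻ p, f p ∂unif := by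
  have h : MeasurePreserving (fun p : ℝ => 1 - p) volume volume :=
    Measure.measurePreserving_sub_left volume 1
  have h2 := h.setLIntegral_comp_preimage_emb
    (MeasurableEquiv.subLeft (1 : ℝ)).measurableEmbedding f (Set.Ioo 0 1)
  simpa [unif] using h2

/-- For 0 < p < 1 one has R + pS ≥ p(R + S), and the exponent b - 1 is nonpositive. -/
lemma lintegral_add_mul_rpow_unif_le {b R S : ℝ} (hb : 0 < b) (hb1 : b ≤ 1) (hR : 0 ≤ R)
    (hS : 0 < S) : ∫⁻ p, ENNReal.ofReal ((R + p * S) ^ (b - 1)) ∂unif ≤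
      ENNReal.ofReal (1 / b * (R + S) ^ (b - 1)) := by
  rw [ENNReal.ofReal_mul (by positivity), ← lintegral_rpow_unif hb,
    ← lintegral_mul_const' _ _ ENNReal.ofReal_ne_top]
  refine lintegral_mono_ae (ae_unif.mono fun p hp => ?_)
  rw [← ENNReal.ofReal_mul (Real.rpow_nonneg hp.1.le _),
    ← Real.mul_rpow hp.1.le (by positivity)]
  refine ENNReal.ofReal_le_ofReal (Real.rpow_le_rpow_of_nonpos ?_ ?_ (by linarith))
  · exact mul_pos hp.1 (by positivity)
  · nlinarith [hp.2]

/-- The density is at most r on (0, 1), where the power is integrable; beyond 1 the power is at most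
1. -/
lemma lintegral_rpow_expMeasure_ne_top {b r : ℝ} (hb : 0 < b) (hb1 : b ≤ 1) (hr : 0 < r) :
    ∫⁻ x, ENNReal.ofReal (x ^ (b - 1)) ∂expMeasure r ≠ ⊤ := by
  have hp := isProbabilityMeasure_expMeasure hr
  have hle : ∫⁻ x, ENNReal.ofReal (x ^ (b - 1)) ∂expMeasure r ≤
      ∫⁻ x, ((Set.Ioo 0 1).indicator (fun x : ℝ => ENNReal.ofReal (x ^ (b - 1))) x + 1)
        ∂expMeasure r := by
    refine lintegral_mono_ae ((ae_expMeasure r).mono fun x hx => ?_)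
    by_cases h : x < 1
    · rw [Set.indicator_of_mem (by exact ⟨hx, h⟩)]
      exact le_self_add
    · refine le_trans ?_ le_add_self
      rw [ENNReal.ofReal_le_one]
      exact Real.rpow_le_one_of_one_le_of_nonpos (not_lt.1 h) (by linarith)
  refine ne_top_of_le_ne_top ?_ hle
  rw [lintegral_add_right _ measurable_const, lintegral_const, measure_univ, one_mul,
    lintegral_indicator measurableSet_Ioo]
  refine ENNReal.add_ne_top.2 ⟨?_, ENNReal.one_ne_top⟩
  have hd : (expMeasure r).restrict (Set.Ioo 0 1) ≤ ENNReal.ofReal r • unif := by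
    rw [expMeasure, gammaMeasure, restrict_withDensity measurableSet_Ioo, unif,
      ← withDensity_const]
    refine withDensity_mono ((ae_restrict_mem measurableSet_Ioo).mono fun x hx => ?_)
    rw [gammaPDF_of_nonneg hx.1.le]
    refine ENNReal.ofReal_le_ofReal ?_
    have : Real.exp (-(r * x)) ≤ 1 :=
      Real.exp_le_one_iff.2 (neg_nonpos.2 (mul_nonneg hr.le hx.1.le))
    simpa using mul_le_of_le_one_right hr.le this
  refine ne_top_of_le_ne_top ?_ (lintegral_mono' hd le_rfl)
  rw [lintegral_smul_measure, lintegral_rpow_unif hb, smul_eq_mul]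
  exact ENNReal.mul_ne_top ENNReal.ofReal_ne_top ENNReal.ofReal_ne_top

/-- Below a threshold δ the factor x^(βα-γ) is at most ε/M, and x^(-βα) ≤ v^α; above it the left
side is bounded. The choice of δ makes δ^(βα-γ) = ε/M. -/
lemma exists_mul_rpow_le {M β γ α ε : ℝ} (hM : 0 < M) (hγ : 0 ≤ γ) (hα : 0 ≤ α)
    (hγβ : γ < β * α) (hε : 0 < ε) :
    ∃ C : ℝ, 0 ≤ C ∧ ∀ x v : ℝ, 0 < x → x ^ (-β) ≤ v → M * x ^ (-γ) ≤ ε * v ^ α + C := by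
  have hd : 0 < β * α - γ := by linarith
  set δ : ℝ := (ε / M) ^ (1 / (β * α - γ)) with hδ
  have hδ0 : 0 < δ := by positivity
  refine ⟨M * δ ^ (-γ), by positivity, fun x v hx hv => ?_⟩
  have hxv : x ^ (-(β * α)) ≤ v ^ α := by
    rw [← neg_mul, Real.rpow_mul hx.le]
    exact Real.rpow_le_rpow (by positivity) hv hα
  have hv0 : 0 ≤ v ^ α := le_trans (by positivity) hxv
  rcases le_total x δ with h | h
  · have h1 : x ^ (β * α - γ) ≤ ε / M := by
      calc x ^ (β * α - γ) ≤ δ ^ (β * α - γ) := by gcongr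
        _ = ε / M := by
          rw [hδ, ← Real.rpow_mul (by positivity), one_div_mul_cancel hd.ne', Real.rpow_one]
    have h2 : x ^ (-γ) = x ^ (β * α - γ) * x ^ (-(β * α)) := by
      rw [← Real.rpow_add hx]; congr 1; ring
    calc M * x ^ (-γ) = M * x ^ (β * α - γ) * x ^ (-(β * α)) := by rw [h2]; ring
      _ ≤ M * (ε / M) * v ^ α := by gcongr
      _ = ε * v ^ α := by field_simp
      _ ≤ _ := le_add_of_nonneg_right (by positivity)
  · have : x ^ (-γ) ≤ δ ^ (-γ) := Real.rpow_le_rpow_of_nonpos hδ0 h (by linarith)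
    have : M * x ^ (-γ) ≤ M * δ ^ (-γ) := by gcongr
    have : 0 ≤ ε * v ^ α := by positivity
    linarith

/-- Inverting the hypothesis gives √x ≥ v^(-1/(2(1-η))). The -1 covers v ≤ 1, where the power is at
most 1. -/
lemma rpow_sub_one_le_min_mul {η x v : ℝ} (h : η < 1 / 2) (hx : 0 < x)
    (hv : x ^ (η - 1) ≤ v) :
    v ^ (1 - 1 / (2 * (1 - η))) - 1 ≤ min 1 (Real.sqrt x) * v := by
  have hv0 : 0 < v := lt_of_lt_of_le (by positivity) hv
  have hη : 0 < 1 - η := by linarith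
  have hα1 : 1 / (2 * (1 - η)) ≤ 1 := by rw [div_le_one (by linarith)]; linarith
  have hα0 : 0 ≤ 1 / (2 * (1 - η)) := by positivity
  rcases le_total v 1 with hv1 | hv1
  · have : v ^ (1 - 1 / (2 * (1 - η))) ≤ 1 := Real.rpow_le_one hv0.le hv1 (by linarith)
    have : 0 ≤ min 1 (Real.sqrt x) * v := by positivity
    linarith
  · rcases min_choice 1 (Real.sqrt x) with hm | hm <;> rw [hm]
    · have : v ^ (1 - 1 / (2 * (1 - η))) ≤ v ^ (1 : ℝ) :=
        Real.rpow_le_rpow_of_exponent_le hv1 (by linarith)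
      rw [Real.rpow_one] at this
      linarith
    · have h1 : v ^ (-(1 / (2 * (1 - η)))) ≤ Real.sqrt x := by
        calc v ^ (-(1 / (2 * (1 - η)))) ≤ (x ^ (η - 1)) ^ (-(1 / (2 * (1 - η)))) :=
              Real.rpow_le_rpow_of_nonpos (by positivity) hv (by linarith)
          _ = Real.sqrt x := by
              rw [← Real.rpow_mul hx.le, Real.sqrt_eq_rpow]
              congr 1
              field_simp
              ring
      have h2 : v ^ (1 - 1 / (2 * (1 - η))) = v ^ (-(1 / (2 * (1 - η)))) * v := by
        rw [sub_eq_neg_add, Real.rpow_add hv0, Real.rpow_one]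
      have := mul_le_mul_of_nonneg_right h1 hv0.le
      linarith

end Powers

/-! ### Block energies and their change at a ring -/

section Blocks

/-- The blocks of consecutive sites, as pairs of a length and a first site. -/
def blocks (n : ℕ) : Finset (Σ _ : ℕ, ℕ) :=
  (Finset.Icc 1 (n + 1)).sigma fun m => Finset.Icc 1 (n + 1 - m + 1)

lemma mem_blocks {n m k : ℕ} : (⟨m, k⟩ : Σ _ : ℕ, ℕ) ∈ blocks n ↔ 1 ≤ m ∧ 1 ≤ k ∧ k + m ≤ n + 2 := by
  simp only [blocks, Finset.mem_sigma, Finset.mem_Icc]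
  omega

/-- The contribution of a block to the Lyapunov function. -/
def blockTerm {n : ℕ} (η : ℝ) (q : Σ _ : ℕ, ℕ) (E : Config n) : ℝ :=
  blockEnergy E q.1 q.2 ^ (coeff (n + 1) q.1 * η - 1)

lemma lyapunov_eq_sum {n : ℕ} (η : ℝ) (E : Config n) :
    lyapunov η E = ∑ q ∈ blocks n, blockTerm η q E := by
  rw [blocks, Finset.sum_sigma]
  rfl

lemma measurable_blockTerm {n : ℕ} (η : ℝ) (q : Σ _ : ℕ, ℕ) :
    Measurable (blockTerm (n := n) η q) := by
  refine Measurable.pow_const (Finset.measurable_sum _ fun j _ => ?_) _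
  split_ifs
  · exact measurable_pi_apply j
  · exact measurable_const

lemma measurable_lyapunov {n : ℕ} (η : ℝ) : Measurable (lyapunov (n := n) η) := by
  simp only [funext (lyapunov_eq_sum (n := n) η)]
  exact Finset.measurable_sum _ fun q _ => measurable_blockTerm η q

lemma le_blockEnergy {n : ℕ} {E : Config n} (hE : ∀ j, 0 < E j) {m k : ℕ} (s : Fin (n + 1))
    (hs : k ≤ (s : ℕ) + 1 ∧ (s : ℕ) + 1 < k + m) : E s ≤ blockEnergy E m k := by
  have := Finset.single_le_sum (f := fun j : Fin (n + 1) =>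
    if k ≤ (j : ℕ) + 1 ∧ (j : ℕ) + 1 < k + m then E j else 0)
    (fun j _ => by split_ifs; exacts [(hE j).le, le_rfl]) (Finset.mem_univ s)
  simpa [hs, blockEnergy] using this

lemma blockEnergy_pos {n : ℕ} {E : Config n} (hE : ∀ j, 0 < E j) {m k : ℕ}
    (h : (⟨m, k⟩ : Σ _ : ℕ, ℕ) ∈ blocks n) : 0 < blockEnergy E m k := by
  rw [mem_blocks] at h
  exact (hE _).trans_le (le_blockEnergy hE ⟨k - 1, by omega⟩ (by simp only; omega))

lemma blockTerm_pos {n : ℕ} {E : Config n} (hE : ∀ j, 0 < E j) (η : ℝ) {q : Σ _ : ℕ, ℕ}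
    (h : q ∈ blocks n) : 0 < blockTerm η q E :=
  Real.rpow_pos_of_pos (blockEnergy_pos hE h) _

lemma blockTerm_le_lyapunov {n : ℕ} {E : Config n} (hE : ∀ j, 0 < E j) (η : ℝ) {q : Σ _ : ℕ, ℕ}
    (h : q ∈ blocks n) : blockTerm η q E ≤ lyapunov η E := by
  rw [lyapunov_eq_sum]
  exact Finset.single_le_sum (f := fun q => blockTerm η q E)
    (fun q hq => (blockTerm_pos hE η hq).le) h

lemma lyapunov_nonneg {n : ℕ} {E : Config n} (hE : ∀ j, 0 < E j) (η : ℝ) : 0 ≤ lyapunov η E := by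
  rw [lyapunov_eq_sum]
  exact Finset.sum_nonneg fun q hq => (blockTerm_pos hE η hq).le

lemma blockEnergy_update {n : ℕ} (E : Config n) (s : Fin (n + 1)) (v : ℝ) (m k : ℕ) :
    blockEnergy (Function.update E s v) m k = blockEnergy E m k +
      if k ≤ (s : ℕ) + 1 ∧ (s : ℕ) + 1 < k + m then v - E s else 0 := by
  rw [blockEnergy, blockEnergy, ← sub_eq_iff_eq_add', ← Finset.sum_sub_distrib,
    Finset.sum_eq_single s]
  · split_ifs <;> simp
  · intro j _ hj
    simp [Function.update_of_ne hj]
  · simp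

lemma blockEnergy_extend {n : ℕ} (E : Config n) (s : Fin (n + 1)) {m k m' k' : ℕ}
    (h : ∀ j : ℕ, k' ≤ j + 1 ∧ j + 1 < k' + m' ↔ (k ≤ j + 1 ∧ j + 1 < k + m) ∨ j = s)
    (hs : ¬ (k ≤ (s : ℕ) + 1 ∧ (s : ℕ) + 1 < k + m)) :
    blockEnergy E m' k' = blockEnergy E m k + E s := by
  rw [blockEnergy, blockEnergy, ← sub_eq_iff_eq_add', ← Finset.sum_sub_distrib,
    Finset.sum_eq_single s]
  · simp [h, hs]
  · intro j _ hj
    have : (j : ℕ) ≠ s := fun h => hj (Fin.ext h)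
    simp [h, this]
  · simp

lemma blockEnergy_bulkExchange {n : ℕ} (E : Config n) (i : Fin n) (p : ℝ) (m k : ℕ) :
    blockEnergy (bulkExchange i (E, p)) m k = blockEnergy E m k +
      (if k ≤ (i : ℕ) + 1 ∧ (i : ℕ) + 1 < k + m then
        p * (E i.castSucc + E i.succ) - E i.castSucc else 0) +
      if k ≤ (i : ℕ) + 2 ∧ (i : ℕ) + 2 < k + m then
        (1 - p) * (E i.castSucc + E i.succ) - E i.succ else 0 := by
  have : i.succ ≠ i.castSucc := (Fin.castSucc_lt_succ).ne'
  rw [bulkExchange, blockEnergy_update, blockEnergy_update, Function.update_of_ne this]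
  rfl

/-- The block contains exactly one of the sites with indices `i` and `i + 1`. -/
def Straddles (q : Σ _ : ℕ, ℕ) (i : ℕ) : Prop := q.2 + q.1 = i + 2 ∨ q.2 = i + 2

lemma lintegral_blockTerm_bulkExchange_of_not_straddles {n : ℕ} (η : ℝ) (E : Config n)
    (i : Fin n) {q : Σ _ : ℕ, ℕ} (h : ¬ Straddles q i) :
    ∫⁻ p, ENNReal.ofReal (blockTerm η q (bulkExchange i (E, p))) ∂unif =
      ENNReal.ofReal (blockTerm η q E) := by
  have (p : ℝ) : blockEnergy (bulkExchange i (E, p)) q.1 q.2 = blockEnergy E q.1 q.2 := by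
    rw [Straddles, not_or] at h
    rw [blockEnergy_bulkExchange]
    by_cases hc : q.2 ≤ (i : ℕ) + 1 ∧ (i : ℕ) + 1 < q.2 + q.1
    · rw [if_pos hc, if_pos (by omega)]; ring
    · rw [if_neg hc, if_neg (by omega)]; ring
  simp [blockTerm, this]

/-- The enlarged block contains both exchanging sites. The bound on `E i.castSucc` serves to control
the rate of the clock by the same block energy. -/
lemma lintegral_blockTerm_bulkExchange_of_straddles {n : ℕ} {η : ℝ} (h0 : 0 < η) (h1 : η ≤ 1)
    (i : Fin n) {m k : ℕ} (hq : (⟨m, k⟩ : Σ _ : ℕ, ℕ) ∈ blocks n) (h : Straddles ⟨m, k⟩ i) :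
    ∃ k', (⟨m + 1, k'⟩ : Σ _ : ℕ, ℕ) ∈ blocks n ∧ ∀ E : Config n, (∀ j, 0 < E j) →
      E i.castSucc ≤ blockEnergy E (m + 1) k' ∧
      ∫⁻ p, ENNReal.ofReal (blockTerm η ⟨m, k⟩ (bulkExchange i (E, p))) ∂unif ≤
        ENNReal.ofReal (1 / (coeff (n + 1) m * η) *
          blockEnergy E (m + 1) k' ^ (coeff (n + 1) m * η - 1)) := by
  have hi := i.2
  have hq' := mem_blocks.1 hq
  have hb : 0 < coeff (n + 1) m * η := mul_pos (coeff_pos hq'.1 (by omega)) h0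
  have hb1 : coeff (n + 1) m * η ≤ 1 :=
    (mul_le_of_le_one_left h0.le (coeff_le_one m)).trans h1
  rcases h with h | h <;> simp only at h
  · refine ⟨k, mem_blocks.2 (by omega), fun E hE => ⟨le_blockEnergy hE _ ?_, ?_⟩⟩
    · simp only [Fin.val_castSucc]; omega
    · have he : blockEnergy E (m + 1) k = blockEnergy E m k + E i.succ :=
        blockEnergy_extend E i.succ (by intro j; simp only [Fin.val_succ]; omega)
          (by simp only [Fin.val_succ]; omega)
      have hR : 0 ≤ blockEnergy E m k - E i.castSucc :=
        sub_nonneg.2 (le_blockEnergy hE _ (by simp only [Fin.val_castSucc]; omega))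
      have hp (p : ℝ) : blockEnergy (bulkExchange i (E, p)) m k =
          (blockEnergy E m k - E i.castSucc) + p * (E i.castSucc + E i.succ) := by
        rw [blockEnergy_bulkExchange, if_pos (by omega), if_neg (by omega)]; ring
      simp only [blockTerm, hp, he]
      refine (lintegral_add_mul_rpow_unif_le hb hb1 hR (add_pos (hE _) (hE _))).trans_eq ?_
      congr 3
      ring
  · refine ⟨k - 1, mem_blocks.2 (by omega), fun E hE => ⟨le_blockEnergy hE _ ?_, ?_⟩⟩
    · simp only [Fin.val_castSucc]; omega
    · have he : blockEnergy E (m + 1) (k - 1) = blockEnergy E m k + E i.castSucc :=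
        blockEnergy_extend E i.castSucc (by intro j; simp only [Fin.val_castSucc]; omega)
          (by simp only [Fin.val_castSucc]; omega)
      have hR : 0 ≤ blockEnergy E m k - E i.succ :=
        sub_nonneg.2 (le_blockEnergy hE _ (by simp only [Fin.val_succ]; omega))
      have hp (p : ℝ) : blockEnergy (bulkExchange i (E, p)) m k =
          (blockEnergy E m k - E i.succ) + (1 - p) * (E i.castSucc + E i.succ) := by
        rw [blockEnergy_bulkExchange, if_neg (by omega), if_pos (by omega)]; ring
      simp only [blockTerm, hp, he]
      -- Here the block receives the share 1 - p, which has the same law as p.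
      rw [lintegral_unif_reflect fun p => ENNReal.ofReal
        ((blockEnergy E m k - E i.succ + p * (E i.castSucc + E i.succ)) ^
          (coeff (n + 1) m * η - 1))]
      refine (lintegral_add_mul_rpow_unif_le hb hb1 hR (add_pos (hE _) (hE _))).trans_eq ?_
      congr 3
      ring

/-- The site with index `s` belongs to the block. -/
def Contains (q : Σ _ : ℕ, ℕ) (s : ℕ) : Prop := q.2 ≤ s + 1 ∧ s + 1 < q.2 + q.1

lemma blockTerm_bathExchange_of_not_contains {n : ℕ} (η : ℝ) (E : Config n) (s : Fin (n + 1))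
    (w : ℝ × ℝ) {q : Σ _ : ℕ, ℕ} (h : ¬ Contains q s) :
    blockTerm η q (bathExchange s (E, w)) = blockTerm η q E := by
  rw [blockTerm, blockTerm, bathExchange, blockEnergy_update, if_neg (by exact h), add_zero]

/-- The new block energy is at least xp, whatever E is, and the powers of x and p have independent
finite means. -/
lemma exists_lintegral_blockTerm_bathExchange_le {n : ℕ} {η T : ℝ} (h0 : 0 < η) (h1 : η ≤ 1)
    (hT : 0 < T) (s : Fin (n + 1)) {q : Σ _ : ℕ, ℕ} (hq : q ∈ blocks n) (h : Contains q s) :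
    ∃ C : ℝ, 0 ≤ C ∧ ∀ E : Config n, (∀ j, 0 < E j) →
      ∫⁻ w, ENNReal.ofReal (blockTerm η q (bathExchange s (E, w)))
        ∂(expMeasure (1 / T)).prod unif ≤ ENNReal.ofReal C := by
  have hq' := mem_blocks.1 hq
  set b := coeff (n + 1) q.1 * η with hbdef
  have hb : 0 < b := mul_pos (coeff_pos hq'.1 (by omega)) h0
  have hb1 : b ≤ 1 := (mul_le_of_le_one_left h0.le (coeff_le_one _)).trans h1
  have hfin : (∫⁻ x, ENNReal.ofReal (x ^ (b - 1)) ∂expMeasure (1 / T)) *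
      ENNReal.ofReal (1 / b) ≠ ⊤ :=
    ENNReal.mul_ne_top (lintegral_rpow_expMeasure_ne_top hb hb1 (by positivity))
      ENNReal.ofReal_ne_top
  refine ⟨((∫⁻ x, ENNReal.ofReal (x ^ (b - 1)) ∂expMeasure (1 / T)) *
    ENNReal.ofReal (1 / b)).toReal, ENNReal.toReal_nonneg, fun E hE => ?_⟩
  rw [ENNReal.ofReal_toReal hfin, ← lintegral_rpow_unif hb,
    ← lintegral_prod_mul (by fun_prop) (by fun_prop)]
  refine lintegral_mono_ae ((ae_prod_exp_unif _).mono fun w hw => ?_)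
  rw [← ENNReal.ofReal_mul (Real.rpow_nonneg hw.1.le _),
    ← Real.mul_rpow hw.1.le hw.2.1.le]
  refine ENNReal.ofReal_le_ofReal (Real.rpow_le_rpow_of_nonpos (mul_pos hw.1 hw.2.1) ?_
    (by linarith))
  rw [bathExchange, blockEnergy_update, if_pos (by exact h)]
  have := le_blockEnergy hE s h
  nlinarith [mul_pos hw.2.1 (hE s)]

end Blocks

/-! ### Gain against loss, clock by clock -/

section Edges

variable {n : ℕ}

/-- The rate of a clock; `Sum.inr false` and `Sum.inr true` are the clocks of the two baths. -/
def edgeRate (K TL TR : ℝ) (E : Config n) : Fin n ⊕ Bool → ℝ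
  | .inl i => rate K (E i.castSucc) (E i.succ)
  | .inr false => rate K TL (E 0)
  | .inr true => rate K (E (Fin.last n)) TR

/-- The law of the configuration after a ring of a clock. -/
def edgeLaw (TL TR : ℝ) (E : Config n) : Fin n ⊕ Bool → Measure (Config n)
  | .inl i => bulkLaw i E
  | .inr false => bathLaw 0 TL E
  | .inr true => bathLaw (Fin.last n) TR E

/-- A ring of the clock changes the energy of the block. -/
def Affects (q : Σ _ : ℕ, ℕ) : Fin n ⊕ Bool → Prop
  | .inl i => Straddles q i
  | .inr false => Contains q (0 : Fin (n + 1))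
  | .inr true => Contains q (Fin.last n)

lemma totalRate_eq_sum (K TL TR : ℝ) (E : Config n) :
    totalRate K TL TR E = ∑ e, edgeRate K TL TR E e := by
  simp only [Fintype.sum_sum_type, Fintype.sum_bool, edgeRate, totalRate]
  ring

lemma lintegral_jumpMeasure_eq_sum (K TL TR : ℝ) (E : Config n) (f : Config n → ENNReal) :
    ∫⁻ y, f y ∂jumpMeasure K TL TR E =
      ∑ e, ENNReal.ofReal (edgeRate K TL TR E e) * ∫⁻ y, f y ∂edgeLaw TL TR E e := by
  rw [lintegral_jumpMeasure]
  simp only [Fintype.sum_sum_type, Fintype.sum_bool, edgeRate, edgeLaw]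
  ring

lemma edgeRate_nonneg {K : ℝ} (hK : 0 ≤ K) (TL TR : ℝ) (E : Config n) (e : Fin n ⊕ Bool) :
    0 ≤ edgeRate K TL TR E e := by
  rcases e with i | (_ | _) <;> exact rate_nonneg hK _ _

/-- The clock at the left boundary of the block serves: a bulk clock, or the left bath if the block
starts at site 1. Thus every block term has a loss. -/
lemma exists_affects {q : Σ _ : ℕ, ℕ} (hq : q ∈ blocks n) : ∃ e : Fin n ⊕ Bool, Affects q e := by
  obtain ⟨m, k⟩ := q
  rw [mem_blocks] at hq
  rcases Nat.lt_or_ge 1 k with h | h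
  · exact ⟨.inl ⟨k - 2, by omega⟩, Or.inr (by simp only; omega)⟩
  · exact ⟨.inr false, by simp only [Affects, Contains, Fin.val_zero]; omega⟩

lemma le_rate {c K a b : ℝ} (hK : c ≤ K) (ha : c ≤ Real.sqrt a) (hb : c ≤ Real.sqrt b) :
    c ≤ rate K a b := by
  refine le_min hK ?_
  rcases min_choice a b with h | h <;> rwa [h]

lemma rate_le_sqrt_left (K a b : ℝ) : rate K a b ≤ Real.sqrt a :=
  (min_le_right _ _).trans (Real.sqrt_le_sqrt (min_le_left _ _))

lemma exists_le_edgeRate {K TL TR : ℝ} (hK : 0 < K) (hTL : 0 < TL) (hTR : 0 < TR) :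
    ∃ κ > (0 : ℝ), ∀ (E : Config n) (x : ℝ), (∀ j, x ≤ E j) → ∀ e,
      κ * min 1 (Real.sqrt x) ≤ edgeRate K TL TR E e := by
  refine ⟨min (min K 1) (min (Real.sqrt TL) (Real.sqrt TR)), by positivity,
    fun E x hx => ?_⟩
  set κ := min (min K 1) (min (Real.sqrt TL) (Real.sqrt TR))
  have hκ : 0 ≤ κ := by positivity
  have h1 : κ * min 1 (Real.sqrt x) ≤ κ := mul_le_of_le_one_right hκ (min_le_left _ _)
  have hK' : κ ≤ K := (min_le_left _ _).trans (min_le_left _ _)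
  have hκ1 : κ ≤ 1 := (min_le_left _ _).trans (min_le_right _ _)
  have hL : κ ≤ Real.sqrt TL := (min_le_right _ _).trans (min_le_left _ _)
  have hR : κ ≤ Real.sqrt TR := (min_le_right _ _).trans (min_le_right _ _)
  have hE (j : Fin (n + 1)) : κ * min 1 (Real.sqrt x) ≤ Real.sqrt (E j) :=
    (mul_le_of_le_one_left (by positivity) hκ1).trans
      ((min_le_right _ _).trans (Real.sqrt_le_sqrt (hx j)))
  rintro (i | (_ | _))
  · exact le_rate (h1.trans hK') (hE _) (hE _)
  · exact le_rate (h1.trans hK') (h1.trans hL) (hE _)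
  · exact le_rate (h1.trans hK') (hE _) (h1.trans hR)

open scoped Classical in
/-- The expected gain of a block at the ring of a clock is negligible against a power of the
Lyapunov function. -/
lemma exists_lintegral_edgeLaw_add_le {K TL TR : ℝ} (hK : 0 < K) (hTL : 0 < TL) (hTR : 0 < TR)
    {η : ℝ} (h0 : 0 < η) (hη : η < 1 / 2 ^ (n + 2)) {ε : ℝ} (hε : 0 < ε) {q : Σ _ : ℕ, ℕ}
    (hq : q ∈ blocks n) (e : Fin n ⊕ Bool) :
    ∃ C : ℝ, 0 ≤ C ∧ ∀ E : Config n, (∀ j, 0 < E j) →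
      ENNReal.ofReal (edgeRate K TL TR E e) *
          ∫⁻ y, ENNReal.ofReal (blockTerm η q y) ∂edgeLaw TL TR E e +
        ENNReal.ofReal (if Affects q e then edgeRate K TL TR E e * blockTerm η q E else 0) ≤
      ENNReal.ofReal (edgeRate K TL TR E e * blockTerm η q E +
        (ε * lyapunov η E ^ (1 - 1 / (2 * (1 - η))) + C)) := by
  have hη4 : η < 1 / 4 := hη.trans_le (by
    apply one_div_le_one_div_of_le (by norm_num)
    calc (4 : ℝ) = 2 ^ 2 := by norm_num
      _ ≤ _ := pow_le_pow_right₀ (by norm_num) (by omega))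
  have hmeas : Measurable fun y : Config n => ENNReal.ofReal (blockTerm η q y) :=
    (measurable_blockTerm η q).ennreal_ofReal
  have hR (E : Config n) := edgeRate_nonneg hK.le TL TR E e
  have hV (E : Config n) (hE : ∀ j, 0 < E j) : 0 ≤ lyapunov η E ^ (1 - 1 / (2 * (1 - η))) :=
    Real.rpow_nonneg (lyapunov_nonneg hE η) _
  by_cases ha : Affects q e
  -- When the clock affects the block, the loss cancels the first term on the right, and only the
  -- gain remains to be bounded.
  · have hsuff (G : Config n → ℝ) (C : ℝ) (hC : 0 ≤ C)
        (hG : ∀ E : Config n, (∀ j, 0 < E j) →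
          ∫⁻ y, ENNReal.ofReal (blockTerm η q y) ∂edgeLaw TL TR E e ≤ ENNReal.ofReal (G E) ∧
          edgeRate K TL TR E e * G E ≤ ε * lyapunov η E ^ (1 - 1 / (2 * (1 - η))) + C)
        (E : Config n) (hE : ∀ j, 0 < E j) :
        ENNReal.ofReal (edgeRate K TL TR E e) *
          ∫⁻ y, ENNReal.ofReal (blockTerm η q y) ∂edgeLaw TL TR E e +
        ENNReal.ofReal (if Affects q e then edgeRate K TL TR E e * blockTerm η q E else 0) ≤
      ENNReal.ofReal (edgeRate K TL TR E e * blockTerm η q E +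
        (ε * lyapunov η E ^ (1 - 1 / (2 * (1 - η))) + C)) := by
      obtain ⟨hG1, hG2⟩ := hG E hE
      have hVE := hV E hE
      rw [if_pos ha, add_comm, ENNReal.ofReal_add (mul_nonneg (hR E) (blockTerm_pos hE η hq).le)
        (by positivity)]
      refine add_le_add le_rfl ((mul_le_mul_right hG1 _).trans ?_)
      rw [← ENNReal.ofReal_mul (hR E)]
      exact ENNReal.ofReal_le_ofReal hG2
    have hbath (s : Fin (n + 1)) (T : ℝ) (hT : 0 < T) (hs : Contains q s)
        (hlaw : ∀ E, edgeLaw TL TR E e = bathLaw s T E)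
        (hrate : ∀ E : Config n, edgeRate K TL TR E e ≤ K) : ∃ C : ℝ, 0 ≤ C ∧
        ∀ E : Config n, (∀ j, 0 < E j) →
          ENNReal.ofReal (edgeRate K TL TR E e) *
            ∫⁻ y, ENNReal.ofReal (blockTerm η q y) ∂edgeLaw TL TR E e +
          ENNReal.ofReal (if Affects q e then edgeRate K TL TR E e * blockTerm η q E else 0) ≤
        ENNReal.ofReal (edgeRate K TL TR E e * blockTerm η q E +
          (ε * lyapunov η E ^ (1 - 1 / (2 * (1 - η))) + C)) := by
      obtain ⟨C, hC, hle⟩ := exists_lintegral_blockTerm_bathExchange_le h0 (by linarith) hT s hq hs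
      refine ⟨K * C, by positivity, hsuff (fun _ => C) _ (by positivity) fun E hE => ⟨?_, ?_⟩⟩
      · rw [hlaw, lintegral_bathLaw s T E hmeas]
        exact hle E hE
      · have := mul_le_mul_of_nonneg_right (hrate E) hC
        have := mul_nonneg hε.le (hV E hE)
        linarith
    rcases e with i | (_ | _)
    · obtain ⟨m, k⟩ := q
      have hq' := mem_blocks.1 hq
      obtain ⟨k', hk', hle⟩ :=
        lintegral_blockTerm_bulkExchange_of_straddles h0 (by linarith) i hq ha
      have hk'' := mem_blocks.1 hk'
      have hb : 0 < coeff (n + 1) m * η := mul_pos (coeff_pos hq'.1 (by omega)) h0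
      have hb1 : coeff (n + 1) m * η ≤ η := mul_le_of_le_one_left h0.le (coeff_le_one m)
      have hα : 1 / (2 * (1 - η)) ≤ 1 := by
        rw [div_le_one (by linarith)]; linarith
      -- γ is the order of the gain, the rate contributing 1/2; β is the exponent of the enlarged
      -- block in V.
      obtain ⟨C, hC, hpow⟩ := exists_mul_rpow_le (M := 1 / (coeff (n + 1) m * η))
        (γ := 1 / 2 - coeff (n + 1) m * η) (by positivity) (by linarith)
        (by linarith : 0 ≤ 1 - 1 / (2 * (1 - η))) (coeff_gap hq'.1 (by omega) h0 hη) hε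
      refine ⟨C, hC, hsuff (fun E => 1 / (coeff (n + 1) m * η) *
        blockEnergy E (m + 1) k' ^ (coeff (n + 1) m * η - 1)) C hC fun E hE => ⟨?_, ?_⟩⟩
      · exact (lintegral_bulkLaw i E hmeas).trans_le (hle E hE).2
      · have hS := blockEnergy_pos hE hk'
        have hv : blockEnergy E (m + 1) k' ^ (-(1 - coeff (n + 1) (m + 1) * η)) ≤
            lyapunov η E := by
          rw [neg_sub]
          exact blockTerm_le_lyapunov hE η hk'
        refine le_trans ?_ (hpow _ _ hS hv)
        have hr : edgeRate K TL TR E (.inl i) ≤ blockEnergy E (m + 1) k' ^ (1 / 2 : ℝ) := by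
          rw [← Real.sqrt_eq_rpow]
          exact (rate_le_sqrt_left _ _ _).trans (Real.sqrt_le_sqrt (hle E hE).1)
        have he : blockEnergy E (m + 1) k' ^ (-(1 / 2 - coeff (n + 1) m * η)) =
            blockEnergy E (m + 1) k' ^ (1 / 2 : ℝ) *
              blockEnergy E (m + 1) k' ^ (coeff (n + 1) m * η - 1) := by
          rw [← Real.rpow_add hS]; congr 1; ring
        rw [he, mul_left_comm]
        gcongr
    · exact hbath 0 TL hTL ha (fun _ => rfl) fun _ => min_le_left _ _
    · exact hbath (Fin.last n) TR hTR ha (fun _ => rfl) fun _ => min_le_left _ _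
  · refine ⟨0, le_rfl, fun E hE => ?_⟩
    have hint : ∫⁻ y, ENNReal.ofReal (blockTerm η q y) ∂edgeLaw TL TR E e ≤
        ENNReal.ofReal (blockTerm η q E) := by
      have hb (s : Fin (n + 1)) (T : ℝ) (hT : 0 < T) (hs : ¬ Contains q s) :
          ∫⁻ y, ENNReal.ofReal (blockTerm η q y) ∂bathLaw s T E ≤
            ENNReal.ofReal (blockTerm η q E) := by
        have := isProbabilityMeasure_expMeasure (one_div_pos.2 hT)
        rw [lintegral_bathLaw s T E hmeas]
        simp only [blockTerm_bathExchange_of_not_contains η E s _ hs, lintegral_const,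
          measure_univ, mul_one, le_refl]
      rcases e with i | (_ | _)
      · exact ((lintegral_bulkLaw i E hmeas).trans
          (lintegral_blockTerm_bulkExchange_of_not_straddles η E i ha)).le
      · exact hb _ _ hTL ha
      · exact hb _ _ hTR ha
    have hVE := hV E hE
    rw [if_neg ha, ENNReal.ofReal_zero, add_zero]
    refine (mul_le_mul_right hint _).trans ?_
    rw [← ENNReal.ofReal_mul (hR E)]
    refine ENNReal.ofReal_le_ofReal ?_
    have : 0 ≤ ε * lyapunov η E ^ (1 - 1 / (2 * (1 - η))) := by positivity
    linarith

open scoped Classical in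
/-- The loss terms dominate a power of the Lyapunov function. -/
lemma exists_lyapunov_rpow_le_loss {K TL TR : ℝ} (hK : 0 < K) (hTL : 0 < TL) (hTR : 0 < TR)
    {η : ℝ} (hη : η < 1 / 2) :
    ∃ κ > (0 : ℝ), ∀ E : Config n, (∀ j, 0 < E j) →
      κ * lyapunov η E ^ (1 - 1 / (2 * (1 - η))) ≤ (∑ q ∈ blocks n, ∑ e : Fin n ⊕ Bool,
        if Affects q e then edgeRate K TL TR E e * blockTerm η q E else 0) + κ := by
  obtain ⟨κ, hκ, hrate⟩ := exists_le_edgeRate (n := n) hK hTL hTR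
  refine ⟨κ, hκ, fun E hE => ?_⟩
  -- The poorest site bounds all rates from below and, as a block of length 1 with a_1 = 1, bounds V
  -- from below.
  obtain ⟨i₀, hi₀⟩ := Finite.exists_min E
  have hv : E i₀ ^ (η - 1) ≤ lyapunov η E := by
    have hq : (⟨1, (i₀ : ℕ) + 1⟩ : Σ _ : ℕ, ℕ) ∈ blocks n := mem_blocks.2 (by omega)
    refine le_trans ?_ (blockTerm_le_lyapunov hE η hq)
    have : blockEnergy E 1 ((i₀ : ℕ) + 1) = E i₀ := by
      rw [blockEnergy, Finset.sum_eq_single i₀]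
      · simp
      · intro j _ hj
        have : (j : ℕ) ≠ i₀ := fun h => hj (Fin.ext h)
        rw [if_neg (by omega)]
      · simp
    simp [blockTerm, this, coeff_one]
  have hmin := rpow_sub_one_le_min_mul hη (hE i₀) hv
  have hloss : κ * min 1 (Real.sqrt (E i₀)) * lyapunov η E ≤ ∑ q ∈ blocks n,
      ∑ e : Fin n ⊕ Bool, if Affects q e then edgeRate K TL TR E e * blockTerm η q E else 0 := by
    rw [lyapunov_eq_sum, Finset.mul_sum]
    refine Finset.sum_le_sum fun q hq => ?_
    have hw := (blockTerm_pos hE η hq).le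
    obtain ⟨e, he⟩ := exists_affects hq
    have h1 := Finset.single_le_sum (f := fun e : Fin n ⊕ Bool =>
      if Affects q e then edgeRate K TL TR E e * blockTerm η q E else 0)
      (fun e _ => by
        split_ifs
        · exact mul_nonneg (edgeRate_nonneg hK.le TL TR E e) hw
        · exact le_rfl) (Finset.mem_univ e)
    rw [if_pos he] at h1
    exact (mul_le_mul_of_nonneg_right (hrate E _ hi₀ e) hw).trans h1
  have := mul_le_mul_of_nonneg_left hmin hκ.le
  linarith

/-- The drift inequality for the jump measure. -/
lemma exists_lintegral_lyapunov_jumpMeasure_add_le {K TL TR : ℝ} (hK : 0 < K) (hTL : 0 < TL)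
    (hTR : 0 < TR) {η : ℝ} (h0 : 0 < η) (hη : η < 1 / 2 ^ (n + 2)) :
    ∃ c > (0 : ℝ), ∃ C ≥ (0 : ℝ), ∀ E : Config n, (∀ j, 0 < E j) →
      ∫⁻ y, ‖lyapunov η y‖ₑ ∂jumpMeasure K TL TR E +
        ENNReal.ofReal (c * lyapunov η E ^ (1 - 1 / (2 * (1 - η)))) ≤
      ENNReal.ofReal (totalRate K TL TR E * lyapunov η E + C) := by
  classical
  have hη2 : η < 1 / 2 := hη.trans_le (by
    apply one_div_le_one_div_of_le (by norm_num)
    calc (2 : ℝ) = 2 ^ 1 := by norm_num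
      _ ≤ _ := pow_le_pow_right₀ (by norm_num) (by omega))
  obtain ⟨κ, hκ, hloss⟩ := exists_lyapunov_rpow_le_loss (n := n) hK hTL hTR hη2
  -- There are A - 1 pairs of a block and a clock. With ε = κ/2/A the gains use at most half of the
  -- loss; the +1 keeps A positive.
  set A : ℝ := ((blocks n).card : ℝ) * (Fintype.card (Fin n ⊕ Bool) : ℝ) + 1 with hA
  have hA0 : 0 < A := by positivity
  have hgain (q : Σ _ : ℕ, ℕ) (e : Fin n ⊕ Bool) := fun hq : q ∈ blocks n =>
    exists_lintegral_edgeLaw_add_le hK hTL hTR h0 hη (ε := κ / 2 / A) (by positivity) hq e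
  choose! C hC hgain using hgain
  refine ⟨κ / 2, by positivity, (∑ q ∈ blocks n, ∑ e, C q e) + κ, ?_, fun E hE => ?_⟩
  · exact add_nonneg (Finset.sum_nonneg fun q hq => Finset.sum_nonneg fun e _ => hC q e hq) hκ.le
  set v := lyapunov η E ^ (1 - 1 / (2 * (1 - η))) with hv
  have hv0 : 0 ≤ v := Real.rpow_nonneg (lyapunov_nonneg hE η) _
  set D := ∑ q ∈ blocks n, ∑ e : Fin n ⊕ Bool,
        if Affects q e then edgeRate K TL TR E e * blockTerm η q E else 0 with hD
  have hr (e) := edgeRate_nonneg hK.le TL TR E e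
  have hw (q) (hq : q ∈ blocks n) := (blockTerm_pos hE η hq).le
  have hterm (q) (hq : q ∈ blocks n) (e) :
      0 ≤ if Affects q e then edgeRate K TL TR E e * blockTerm η q E else 0 := by
    split_ifs
    · exact mul_nonneg (hr e) (hw q hq)
    · exact le_rfl
  have hJ : ∫⁻ y, ‖lyapunov η y‖ₑ ∂jumpMeasure K TL TR E ≤ ∑ q ∈ blocks n, ∑ e : Fin n ⊕ Bool,
      ENNReal.ofReal (edgeRate K TL TR E e) *
        ∫⁻ y, ENNReal.ofReal (blockTerm η q y) ∂edgeLaw TL TR E e := by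
    calc _ ≤ ∫⁻ y, ∑ q ∈ blocks n, ENNReal.ofReal (blockTerm η q y) ∂jumpMeasure K TL TR E := by
          refine lintegral_jumpMeasure_mono K TL TR hE fun y hy => ?_
          rw [Real.enorm_of_nonneg (lyapunov_nonneg hy η), lyapunov_eq_sum,
            ENNReal.ofReal_sum_of_nonneg fun q hq => (blockTerm_pos hy η hq).le]
      _ = _ := by
          rw [lintegral_finsetSum _ fun q _ => (measurable_blockTerm η q).ennreal_ofReal]
          simp only [lintegral_jumpMeasure_eq_sum]
  have hsum : ∫⁻ y, ‖lyapunov η y‖ₑ ∂jumpMeasure K TL TR E + ENNReal.ofReal D ≤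
      ENNReal.ofReal (totalRate K TL TR E * lyapunov η E + (κ / 2 * v +
        ∑ q ∈ blocks n, ∑ e, C q e)) := by
    calc _ ≤ ∑ q ∈ blocks n, ∑ e : Fin n ⊕ Bool, ENNReal.ofReal
          (edgeRate K TL TR E e * blockTerm η q E + (κ / 2 / A * v + C q e)) := by
          rw [hD, ENNReal.ofReal_sum_of_nonneg fun q hq => Finset.sum_nonneg fun e _ => hterm q hq e]
          refine (add_le_add hJ le_rfl).trans ?_
          rw [← Finset.sum_add_distrib]
          refine Finset.sum_le_sum fun q hq => ?_
          rw [ENNReal.ofReal_sum_of_nonneg fun e _ => hterm q hq e, ← Finset.sum_add_distrib]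
          exact Finset.sum_le_sum fun e _ => hgain q e hq E hE
      _ = ENNReal.ofReal (∑ q ∈ blocks n, ∑ e : Fin n ⊕ Bool,
          (edgeRate K TL TR E e * blockTerm η q E + (κ / 2 / A * v + C q e))) := by
          have hnn (q) (hq : q ∈ blocks n) (e) :
              0 ≤ edgeRate K TL TR E e * blockTerm η q E + (κ / 2 / A * v + C q e) :=
            add_nonneg (mul_nonneg (hr e) (hw q hq)) (add_nonneg (by positivity) (hC q e hq))
          rw [ENNReal.ofReal_sum_of_nonneg fun q hq => Finset.sum_nonneg fun e _ => hnn q hq e]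
          exact Finset.sum_congr rfl fun q hq =>
            (ENNReal.ofReal_sum_of_nonneg fun e _ => hnn q hq e).symm
      _ ≤ _ := by
          refine ENNReal.ofReal_le_ofReal ?_
          simp only [Finset.sum_add_distrib, ← Finset.sum_mul, ← Finset.mul_sum,
            ← totalRate_eq_sum, ← lyapunov_eq_sum, Finset.sum_const, nsmul_eq_mul,
            Finset.card_univ]
          have hle : ((blocks n).card : ℝ) * ((Fintype.card (Fin n ⊕ Bool) : ℝ) *
              (κ / 2 / A * v)) ≤ κ / 2 * v := by
            calc _ = (A - 1) / A * (κ / 2 * v) := by rw [hA]; ring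
              _ ≤ 1 * (κ / 2 * v) := by
                gcongr
                rw [div_le_one hA0]; linarith
              _ = _ := one_mul _
          linarith
  have hfin : ENNReal.ofReal (κ / 2 * v) ≠ ⊤ := ENNReal.ofReal_ne_top
  -- Adding κ/2 · v to both sides avoids subtraction in `ENNReal`: the full loss κv then appears on
  -- the left.
  refine (ENNReal.add_le_add_iff_right hfin).1 ?_
  have hCs : 0 ≤ ∑ q ∈ blocks n, ∑ e, C q e :=
    Finset.sum_nonneg fun q hq => Finset.sum_nonneg fun e _ => hC q e hq
  have hrV : 0 ≤ totalRate K TL TR E * lyapunov η E :=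
    mul_nonneg (totalRate_nonneg hK.le TL TR E) (lyapunov_nonneg hE η)
  have hD0 : 0 ≤ D := Finset.sum_nonneg fun q hq => Finset.sum_nonneg fun e _ => hterm q hq e
  calc _ = ∫⁻ y, ‖lyapunov η y‖ₑ ∂jumpMeasure K TL TR E + ENNReal.ofReal (κ * v) := by
        rw [add_assoc, ← ENNReal.ofReal_add (by positivity) (by positivity)]
        congr 2
        ring
    _ ≤ ∫⁻ y, ‖lyapunov η y‖ₑ ∂jumpMeasure K TL TR E + (ENNReal.ofReal D + ENNReal.ofReal κ) := by
        rw [← ENNReal.ofReal_add hD0 hκ.le]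
        exact add_le_add le_rfl (ENNReal.ofReal_le_ofReal (hloss E hE))
    _ ≤ ENNReal.ofReal (totalRate K TL TR E * lyapunov η E + (κ / 2 * v +
        ∑ q ∈ blocks n, ∑ e, C q e)) + ENNReal.ofReal κ := by
        rw [← add_assoc]
        exact add_le_add hsum le_rfl
    _ = _ := by
        rw [← ENNReal.ofReal_add (by positivity) hκ.le, ← ENNReal.ofReal_add (by positivity)
          (by positivity)]
        congr 1
        ring

end Edges

end EnergyExchange

end

/-! ### Drift over a time step -/

theorem mainTheorem5 (n : ℕ) (K TL TR : ℝ) (hK : 0 < K) (hTL : 0 < TL) (hTR : 0 < TR) :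
    ∃ η₀ > (0 : ℝ), ∃ h₀ > (0 : ℝ), ∀ η : ℝ, 0 < η → η < η₀ → ∀ h : ℝ, 0 < h → h < h₀ →
      ∃ c₀ > (0 : ℝ), ∃ M₀ > (1 : ℝ), ∀ E : EnergyExchange.Config n, (∀ i, 0 < E i) →
        M₀ < EnergyExchange.lyapunov η E →
          MeasureTheory.Integrable (EnergyExchange.lyapunov η)
              (EnergyExchange.transition K TL TR h E) ∧
            (∫ x, EnergyExchange.lyapunov η x ∂(EnergyExchange.transition K TL TR h E)) -
                EnergyExchange.lyapunov η E ≤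
              -c₀ * EnergyExchange.lyapunov η E ^ (1 - 1 / (2 * (1 - η))) := by
  open EnergyExchange MeasureTheory in
  -- The smallness of η comes from `coeff_gap`. The time h need not be small, so the bound 1 is
  -- arbitrary.
  refine ⟨1 / 2 ^ (n + 2), by positivity, 1, one_pos, fun η h0 hη h hh _ => ?_⟩
  have hη2 : η < 1 / 2 := hη.trans_le (by
    apply one_div_le_one_div_of_le (by norm_num)
    calc (2 : ℝ) = 2 ^ 1 := by norm_num
      _ ≤ _ := pow_le_pow_right₀ (by norm_num) (by omega))
  have hα : 0 < 1 - 1 / (2 * (1 - η)) := by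
    rw [sub_pos, div_lt_one (by linarith)]; linarith
  obtain ⟨c, hc, C, hC, hJ⟩ := exists_lintegral_lyapunov_jumpMeasure_add_le (n := n)
    hK hTL hTR h0 hη
  set α := 1 - 1 / (2 * (1 - η))
  -- A lower bound, uniform in E, for the mean time before the first ring or h, as the total rate is
  -- at most (n + 2)K.
  set p : ℝ := h * Real.exp (-((n + 2) * K * h)) with hp
  have hp0 : 0 < p := by positivity
  -- For V^α ≥ M the error Ch is at most half of the decrease c p V^α, which leaves c₀ = cp/2.
  set M : ℝ := 2 * C * h / (c * p)
  have hM : 0 ≤ M := by positivity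
  refine ⟨c * p / 2, by positivity, max 2 (M ^ α⁻¹), lt_max_of_lt_left (by norm_num),
    fun E hE hVM => ?_⟩
  have hV0 := lyapunov_nonneg hE η
  have hMV : M ≤ lyapunov η E ^ α := by
    calc M = (M ^ α⁻¹) ^ α := (Real.rpow_inv_rpow hM hα.ne').symm
      _ ≤ _ := Real.rpow_le_rpow (by positivity) ((le_max_right _ _).trans hVM.le) hα.le
  have hv0 : 0 ≤ lyapunov η E ^ α := Real.rpow_nonneg hV0 _
  have hmain := lintegral_transition_add_le hK.le (measurable_lyapunov (n := n) η)
    (fun E hE => lyapunov_nonneg hE η) hC hJ hh.le hE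
  have hI : ENNReal.ofReal p ≤ ∫⁻ s in Set.Ioc 0 h,
      ENNReal.ofReal (Real.exp (-(totalRate K TL TR E * s))) := by
    calc ENNReal.ofReal p = ∫⁻ _ in Set.Ioc 0 h,
          ENNReal.ofReal (Real.exp (-((n + 2) * K * h))) := by
          rw [setLIntegral_const, Real.volume_Ioc, sub_zero, ← ENNReal.ofReal_mul (by positivity),
            hp, mul_comm]
      _ ≤ _ := by
          refine setLIntegral_mono' measurableSet_Ioc fun s hs => ?_
          refine ENNReal.ofReal_le_ofReal (Real.exp_le_exp.2 (neg_le_neg ?_))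
          exact mul_le_mul (totalRate_le K TL TR E) hs.2 hs.1.le (by positivity)
  have hfin : ∫⁻ y, ‖lyapunov η y‖ₑ ∂transition K TL TR h E ≠ ⊤ :=
    ne_top_of_le_ne_top ENNReal.ofReal_ne_top (le_self_add.trans hmain)
  have hint : Integrable (lyapunov η) (transition K TL TR h E) :=
    ⟨(measurable_lyapunov η).aestronglyMeasurable, lt_top_iff_ne_top.2 hfin⟩
  refine ⟨hint, ?_⟩
  -- Bounding by the integral of the norm avoids showing that the transition kernel charges only
  -- positive configurations.
  have h1 : ∫ x, lyapunov η x ∂transition K TL TR h E ≤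
      (∫⁻ y, ‖lyapunov η y‖ₑ ∂transition K TL TR h E).toReal := by
    rw [← integral_norm_eq_lintegral_enorm hint.1]
    exact integral_mono hint hint.norm fun x => Real.le_norm_self _
  have h2 : (∫⁻ y, ‖lyapunov η y‖ₑ ∂transition K TL TR h E).toReal + c * lyapunov η E ^ α * p ≤
      lyapunov η E + C * h := by
    have h3 : ∫⁻ y, ‖lyapunov η y‖ₑ ∂transition K TL TR h E +
        ENNReal.ofReal (c * lyapunov η E ^ α * p) ≤ ENNReal.ofReal (lyapunov η E + C * h) := by
      refine le_trans ?_ hmain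
      rw [ENNReal.ofReal_mul (by positivity)]
      gcongr
    have h4 := ENNReal.toReal_mono ENNReal.ofReal_ne_top h3
    rwa [ENNReal.toReal_add hfin ENNReal.ofReal_ne_top, ENNReal.toReal_ofReal (by positivity),
      ENNReal.toReal_ofReal (by positivity)] at h4
  have h5 : C * h ≤ c * p / 2 * lyapunov η E ^ α := by
    calc C * h = c * p / 2 * M := by simp only [M]; field_simp
      _ ≤ _ := by gcongr
  linarith
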